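/- Let $n\ge 0$, $M\ge 1$, let $O_1,\dots,O_M$ be Hermitian $2^n\times 2^n$ matrices and let $\epsilon,\delta\in(0,1]$. A stabilizer state is a state $|s\rangle=C|b\rangle$, where $|b\rangle$ is a computational basis state of $n$ qubits and $C$ is in the group generated by the Hadamard, phase and CNOT gates; states that differ by a global phase are identified, and $\mathrm{STAB}$ is the (finite) set of stabilizer states. The stabilizer measurement of an $n$-qubit state $\rho$ returns $s\in\mathrm{STAB}$ with probability $\frac{2^n}{|\mathrm{STAB}|}\langle s|\rho|s\rangle$. From outcomes $s_1,\dots,s_N$ and a number of batches $K$ with $1\le K\le N$, form $$\hat\rho_{(k)}=\frac{2^n+1}{\lfloor N/K\rfloor}\sum_{j=(k-1)\lfloor N/K\rfloor+1}^{k\lfloor N/K\rfloor}|s_j\rangle\langle s_j|-\mathbb I\quad(1\le k\le K),\qquad \hat o_i(N,K)=\mathrm{median}\{\mathrm{tr}(O_i\hat\rho_{(1)}),\dots,\mathrm{tr}(O_i\hat\rho_{(K)})\},$$ where the median of an even number of values is the mean of the two middle ones. Let $K=\lceil\log(M/\delta)\rceil$ or $K=\lceil 2\log(2M/\delta)\rceil$,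 and let $N$ be any integer with $$N\ \ge\ \frac{204\,\log(2M/\delta)\,\max_i\mathrm{tr}(O_i^2)}{\epsilon^2}\qquad\text{and}\qquad N\ge K .$$ Then for every $n$-qubit state $\rho$ (positive semidefinite, trace one), if $s_1,\dots,s_N$ are the outcomes of $N$ independent stabilizer measurements of $\rho$, with probability at least $1-\delta$, $$|\hat o_i(N,K)-\mathrm{tr}(O_i\rho)|\le\epsilon\quad\text{for all }1\le i\le M .$$ (If $M=\delta=1$ and $K=\lceil\log(M/\delta)\rceil=0$, the claim is void.) -/

import Mathlib

open scoped Matrix ComplexOrder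

noncomputable section

namespace ClassicalShadows

/-- Labels of the computational basis of `n` qubits. -/
abbrev Bits (n : ℕ) : Type := Fin n → ZMod 2

/-- Complex `2^n × 2^n` matrices, indexed by the computational basis. -/
abbrev QMat (n : ℕ) : Type := Matrix (Bits n) (Bits n) ℂ

/-- A quantum state: a positive semidefinite matrix of trace one. -/
def IsState {n : ℕ} (ρ : QMat n) : Prop := ρ.PosSemidef ∧ ρ.trace = 1

/-- The Hadamard gate on qubit `j`, tensored with the identity on the other qubits. -/
def hadamardGate {n : ℕ} (j : Fin n) : QMat n :=
  Matrix.of fun a b =>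
    if ∀ i, i ≠ j → a i = b i then
      (if a j = 1 ∧ b j = 1 then -1 else 1) / ((√2 : ℝ) : ℂ)
    else 0

/-- The phase gate `diag(1, i)` on qubit `j`. -/
def phaseGate {n : ℕ} (j : Fin n) : QMat n :=
  Matrix.diagonal fun b => if b j = 1 then Complex.I else 1

/-- The CNOT gate with control qubit `c` and target qubit `t`:
`|b⟩` is sent to the basis state in which bit `t` is replaced by `b t + b c`. -/
def cnotGate {n : ℕ} (c t : Fin n) : QMat n :=
  Matrix.of fun a b => if a = Function.update b t (b t + b c) then 1 else 0

/-- The `n`-qubit Clifford group: the group of unitaries generated by the Hadamard, phase and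
CNOT gates. -/
def cliffordGroup (n : ℕ) : Subgroup (Matrix.unitaryGroup (Bits n) ℂ) :=
  Subgroup.closure
    {U | (∃ j, (U : QMat n) = hadamardGate j) ∨ (∃ j, (U : QMat n) = phaseGate j) ∨
      ∃ c t, c ≠ t ∧ (U : QMat n) = cnotGate c t}

/-- The rank-one projectors `|s⟩⟨s|` onto stabilizer states `|s⟩ = C|b⟩`, with `C` a Clifford
unitary and `|b⟩` a computational basis state. States that differ by a global phase are
identified. -/
def stabilizerProjectors (n : ℕ) : Set (QMat n) :=
  {P | ∃ C ∈ cliffordGroup n, ∃ b : Bits n,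
    P = (C : QMat n) * Matrix.single b b (1 : ℂ) * (C : QMat n)ᴴ}

/-- A stabilizer state, given by its projector `proj = |s⟩⟨s|`. -/
structure StabState (n : ℕ) where
  proj : QMat n
  mem : proj ∈ stabilizerProjectors n

/-- Every set of stabilizer states is an event. -/
instance (n : ℕ) : MeasurableSpace (StabState n) := ⊤

/-- The outcome distribution (Born's rule) of the stabilizer measurement, that is of the POVM with
elements `(2^n / |STAB|) |s⟩⟨s|`, performed on the state `ρ`: outcome `s` has probability
`(2^n / |STAB|) tr(|s⟩⟨s| ρ)`. -/
def stabilizerMeasurement {n : ℕ} (ρ : QMat n) : MeasureTheory.Measure (StabState n) :=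
  MeasureTheory.Measure.sum fun s : StabState n =>
    ENNReal.ofReal ((2 : ℝ) ^ n / (Nat.card (StabState n) : ℝ) * (s.proj * ρ).trace.re) •
      MeasureTheory.Measure.dirac s

/-- The `k`-th linear inversion estimator, built from the `k`-th of `K` consecutive batches of
`⌊N/K⌋` outcomes (batches and outcomes are numbered from `0`):
`(2^n + 1) / ⌊N/K⌋ * ∑_{j in batch k} |s_j⟩⟨s_j| - 1`. -/
def batchEstimator {n N : ℕ} (K : ℕ) (s : Fin N → StabState n) (k : Fin K) : QMat n :=
  (((2 : ℂ) ^ n + 1) / ((N / K : ℕ) : ℂ)) •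
    (∑ j ∈ Finset.univ.filter (fun j : Fin N =>
      (k : ℕ) * (N / K) ≤ (j : ℕ) ∧ (j : ℕ) < ((k : ℕ) + 1) * (N / K)), (s j).proj) - 1

/-- The median of `K ≥ 1` real numbers: the middle one in sorted order if `K` is odd, the mean of
the two middle ones if `K` is even. -/
def median {K : ℕ} (v : Fin K → ℝ) : ℝ :=
  if h : 0 < K then
    (v (Tuple.sort v ⟨(K - 1) / 2, by omega⟩) + v (Tuple.sort v ⟨K / 2, by omega⟩)) / 2
  else 0

/-- The median of means prediction of `tr(A ρ)` with `K` batches from the outcomes `s`. -/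
def medianOfMeans {n N : ℕ} (K : ℕ) (A : QMat n) (s : Fin N → StabState n) : ℝ :=
  median fun k : Fin K => (A * batchEstimator K s k).trace.re

end ClassicalShadows

end

open scoped Matrix ComplexOrder

namespace ClassicalShadows

/-! The stabilizer states form a complex projective 3-design: the sum of `|s⟩⟨s|^{⊗3}` is a multiple
of the projection onto the symmetric subspace (`sum_trace_mul_trace_mul_trace`). Hence the
single-shot estimator `(2^n + 1)⟨s|A|s⟩ - tr A` has mean `tr(Aρ)` and variance at most `3 tr(A²)`
(`integral_shot`, `variance_shot_le`).

The design property follows from invariance of the third moment tensor under the three gates. Phase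
gates and CNOTs, the latter acting as `GL_n(F_2)` on labels, kill each entry whose column labels are
not a permutation of its row labels (`exists_perm_of_moment_ne_zero`). An entry is thus a weight of
the row labels times a number of permutations. Hadamard invariance makes the weight translation
invariant and gives a mean-value identity. Up to affine maps and permutations, triples in `F_2^n`
are classified by which points coincide, and the identity equates the remaining weights
(`weight_eq_weight_zero`).

For the statistics, Chebyshev bounds by some `q` the failure probability of one batch. The median
fails only if at least `⌈K/2⌉` of the independent batches fail, which has probability at most `2^K
q^⌈K/2⌉`. For either choice of `K` the constant 204 makes this at most `δ/M`
(`two_pow_mul_pow_le_inv`); a union bound over the observables concludes. -/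

/-! ### Characters of `F_2^n`. -/

/-- The sign `(-1)^z` of a bit. -/
def sgn (z : ZMod 2) : ℂ := if z = 1 then -1 else 1

theorem zmod_two_cases (z : ZMod 2) : z = 0 ∨ z = 1 := by
  revert z; decide

@[simp] theorem sgn_zero : sgn 0 = 1 := by simp [sgn]

@[simp] theorem sgn_one : sgn 1 = -1 := by simp [sgn]

theorem sgn_add (a b : ZMod 2) : sgn (a + b) = sgn a * sgn b := by
  rcases zmod_two_cases a with rfl | rfl <;> rcases zmod_two_cases b with rfl | rfl <;>
    simp [CharTwo.add_self_eq_zero]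

theorem sgn_mul_self (a : ZMod 2) : sgn a * sgn a = 1 := by
  rw [← sgn_add, CharTwo.add_self_eq_zero, sgn_zero]

theorem sum_zmod_two {α : Type*} [AddCommMonoid α] (f : ZMod 2 → α) : ∑ u, f u = f 0 + f 1 :=
  Fin.sum_univ_two f

/-- If `z j = 1`, flipping bit `j` of `q` negates every term. This orthogonality drives both Fourier
inversions below. -/
theorem sum_sgn_dotProduct {n : ℕ} (z : Bits n) :
    ∑ q : Bits n, sgn (q ⬝ᵥ z) = if z = 0 then (2 : ℂ) ^ n else 0 := by
  split_ifs with h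
  · subst h; simp
  · obtain ⟨j, hj⟩ : ∃ j, z j ≠ 0 := by
      by_contra! H; exact h (funext H)
    have hj : z j = 1 := (zmod_two_cases _).resolve_left hj
    have key : ∑ q : Bits n, sgn (q ⬝ᵥ z) = -∑ q : Bits n, sgn (q ⬝ᵥ z) := by
      refine (Equiv.sum_comp (Equiv.addRight (Pi.single j 1 : Bits n))
        (fun q => sgn (q ⬝ᵥ z))).symm.trans ?_
      simp [add_dotProduct, sgn_add, hj]
    linear_combination (1 / 2 : ℂ) * key

/-! ### Entries of matrices conjugated by the generating gates. -/

section Gates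

variable {n : ℕ}

theorem sum_ite_eq_off (j : Fin n) (a : Bits n) (g : Bits n → ℂ) :
    (∑ c, if ∀ i, i ≠ j → a i = c i then g c else 0) = ∑ u, g (Function.update a j u) := by
  rw [← Finset.sum_filter]
  symm
  refine Finset.sum_bij (fun u _ => Function.update a j u) ?_ ?_ ?_ ?_
  · intro u _
    simp only [Finset.mem_filter, Finset.mem_univ, true_and]
    intro i hi; simp [hi]
  · intro u _ v _ h
    exact Function.update_injective a j h
  · intro c hc
    simp only [Finset.mem_filter, Finset.mem_univ, true_and] at hc
    refine ⟨c j, Finset.mem_univ _, ?_⟩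
    ext i
    by_cases hi : i = j
    · subst hi; simp
    · simp [hi, hc i hi]
  · intros; rfl

theorem hadamardGate_transpose (j : Fin n) : (hadamardGate j)ᵀ = hadamardGate j := by
  ext a b
  simp only [hadamardGate, Matrix.transpose_apply, Matrix.of_apply, eq_comm, and_comm]

theorem hadamardGate_conjTranspose (j : Fin n) : (hadamardGate j)ᴴ = hadamardGate j := by
  conv_rhs => rw [← hadamardGate_transpose]
  ext a b
  simp only [hadamardGate, Matrix.conjTranspose_apply, Matrix.transpose_apply, Matrix.of_apply]
  split_ifs <;> simp

theorem hadamardGate_mul_apply (j : Fin n) (A : QMat n) (a b : Bits n) :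
    (hadamardGate j * A) a b =
      ((√2 : ℝ) : ℂ)⁻¹ * ∑ u, sgn (a j * u) * A (Function.update a j u) b := by
  rw [Matrix.mul_apply, Finset.mul_sum]
  refine Eq.trans ?_ ((sum_ite_eq_off j a (fun c => if a j = 1 ∧ c j = 1 then
    -((√2 : ℝ) : ℂ)⁻¹ * A c b else ((√2 : ℝ) : ℂ)⁻¹ * A c b)).trans ?_)
  · refine Finset.sum_congr rfl fun c _ => ?_
    simp only [hadamardGate, Matrix.of_apply]
    split_ifs <;> simp [div_eq_mul_inv]
  · refine Finset.sum_congr rfl fun u _ => ?_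
    rcases zmod_two_cases (a j) with h | h <;> rcases zmod_two_cases u with rfl | rfl <;> simp [h]

theorem mul_hadamardGate_apply (j : Fin n) (A : QMat n) (a b : Bits n) :
    (A * hadamardGate j) a b =
      ((√2 : ℝ) : ℂ)⁻¹ * ∑ u, sgn (b j * u) * A a (Function.update b j u) := by
  have := hadamardGate_mul_apply j Aᵀ b a
  rw [← hadamardGate_transpose, ← Matrix.transpose_mul] at this
  simpa using this

theorem inv_sqrt_two_mul_self : ((√2 : ℝ) : ℂ)⁻¹ * ((√2 : ℝ) : ℂ)⁻¹ = 1 / 2 := by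
  rw [← mul_inv, ← Complex.ofReal_mul, Real.mul_self_sqrt (by norm_num)]; norm_num

theorem hadamardGate_mul_mul (j : Fin n) (A : QMat n) :
    hadamardGate j * (hadamardGate j * A) = A := by
  ext a b
  rw [hadamardGate_mul_apply]
  simp only [hadamardGate_mul_apply, Function.update_self, Function.update_idem, sum_zmod_two]
  have h := inv_sqrt_two_mul_self
  have ha := Function.update_eq_self j a
  rcases zmod_two_cases (a j) with h' | h' <;> rw [h'] at ha <;> simp [h', ha]
  · linear_combination (2 * A a b) * h
  · linear_combination (2 * A a b) * h

theorem hadamardGate_mul_self (j : Fin n) : hadamardGate j * hadamardGate j = 1 := by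
  simpa using hadamardGate_mul_mul j 1

theorem conj_hadamardGate_apply (j : Fin n) (A : QMat n) (a b : Bits n) :
    (hadamardGate j * A * (hadamardGate j)ᴴ) a b =
      1 / 2 * ∑ u, ∑ v, sgn (a j * u) * sgn (b j * v) *
        A (Function.update a j u) (Function.update b j v) := by
  rw [hadamardGate_conjTranspose, mul_hadamardGate_apply]
  simp only [hadamardGate_mul_apply, sum_zmod_two]
  have h := inv_sqrt_two_mul_self
  rw [← h]; ring

/-- The eigenvalues `1`, `i` of the phase gate. -/
def phase (z : ZMod 2) : ℂ := if z = 1 then Complex.I else 1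

theorem conj_phaseGate_apply (j : Fin n) (A : QMat n) (a b : Bits n) :
    (phaseGate j * A * (phaseGate j)ᴴ) a b = phase (a j) * A a b * star (phase (b j)) := by
  simp [phaseGate, phase, Matrix.diagonal_conjTranspose, Matrix.mul_diagonal,
    Matrix.diagonal_mul]

theorem phaseGate_mul_conjTranspose (j : Fin n) : phaseGate j * (phaseGate j)ᴴ = 1 := by
  rw [phaseGate, Matrix.diagonal_conjTranspose, Matrix.diagonal_mul_diagonal,
    ← Matrix.diagonal_one]
  congr 1; ext b
  simp only [Pi.star_apply]
  split_ifs <;> simp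

/-- The action of the CNOT gate on computational basis labels. -/
def cnotMap (c t : Fin n) (b : Bits n) : Bits n := Function.update b t (b t + b c)

theorem cnotMap_cnotMap {c t : Fin n} (h : c ≠ t) (b : Bits n) :
    cnotMap c t (cnotMap c t b) = b := by
  ext i
  by_cases hi : i = t
  · subst hi; simp [cnotMap, h, add_assoc, CharTwo.add_self_eq_zero]
  · simp [cnotMap, hi]

theorem eq_cnotMap_iff {c t : Fin n} (h : c ≠ t) (a b : Bits n) :
    a = cnotMap c t b ↔ b = cnotMap c t a := by
  constructor <;> (rintro rfl; rw [cnotMap_cnotMap h])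

theorem cnotGate_conjTranspose {c t : Fin n} (h : c ≠ t) : (cnotGate c t)ᴴ = cnotGate c t := by
  ext a b
  have := eq_cnotMap_iff h a b
  simp only [cnotMap] at this
  simp only [cnotGate, Matrix.conjTranspose_apply, Matrix.of_apply, this]
  split_ifs <;> simp

theorem cnotGate_mul_apply {c t : Fin n} (h : c ≠ t) (A : QMat n) (a b : Bits n) :
    (cnotGate c t * A) a b = A (cnotMap c t a) b := by
  have := fun d => eq_cnotMap_iff h a d
  simp only [cnotMap] at this
  simp [Matrix.mul_apply, cnotGate, this, cnotMap]

theorem mul_cnotGate_apply (c t : Fin n) (A : QMat n) (a b : Bits n) :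
    (A * cnotGate c t) a b = A a (cnotMap c t b) := by
  simp [Matrix.mul_apply, cnotGate, cnotMap]

theorem conj_cnotGate_apply {c t : Fin n} (h : c ≠ t) (A : QMat n) (a b : Bits n) :
    (cnotGate c t * A * (cnotGate c t)ᴴ) a b = A (cnotMap c t a) (cnotMap c t b) := by
  rw [cnotGate_conjTranspose h, mul_cnotGate_apply, cnotGate_mul_apply h]

theorem cnotGate_mul_self {c t : Fin n} (h : c ≠ t) : cnotGate c t * cnotGate c t = 1 := by
  ext a b
  rw [← mul_one (cnotGate c t * cnotGate c t), mul_assoc, cnotGate_mul_apply h,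
    cnotGate_mul_apply h, cnotMap_cnotMap h]

theorem exists_hadamardGate (j : Fin n) : ∃ U ∈ cliffordGroup n, (U : QMat n) = hadamardGate j :=
  ⟨⟨hadamardGate j, Matrix.mem_unitaryGroup_iff.2 (by
    rw [Matrix.star_eq_conjTranspose, hadamardGate_conjTranspose, hadamardGate_mul_self])⟩,
    Subgroup.subset_closure (Or.inl ⟨j, rfl⟩), rfl⟩

theorem exists_phaseGate (j : Fin n) : ∃ U ∈ cliffordGroup n, (U : QMat n) = phaseGate j :=
  ⟨⟨phaseGate j, Matrix.mem_unitaryGroup_iff.2 (phaseGate_mul_conjTranspose j)⟩,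
    Subgroup.subset_closure (Or.inr (Or.inl ⟨j, rfl⟩)), rfl⟩

theorem exists_cnotGate {c t : Fin n} (h : c ≠ t) :
    ∃ U ∈ cliffordGroup n, (U : QMat n) = cnotGate c t :=
  ⟨⟨cnotGate c t, Matrix.mem_unitaryGroup_iff.2 (by
    rw [Matrix.star_eq_conjTranspose, cnotGate_conjTranspose h, cnotGate_mul_self h])⟩,
    Subgroup.subset_closure (Or.inr (Or.inr ⟨c, t, h, rfl⟩)), rfl⟩

end Gates

/-! ### Cliffords permute Paulis; there are finitely many stabilizer states. -/

section Finiteness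

variable {n : ℕ}

/-- The Pauli matrix `X^p Z^q`, up to a phase. -/
def pauli (p q : Bits n) : QMat n :=
  Matrix.of fun a b => if a = b + p then sgn (q ⬝ᵥ b) else 0

/-- The Pauli matrices with phases `1, i, -1, -i`. -/
def pauliSet (n : ℕ) : Set (QMat n) :=
  Set.range fun x : Fin 4 × Bits n × Bits n => Complex.I ^ (x.1 : ℕ) • pauli x.2.1 x.2.2

theorem pauliSet_finite : (pauliSet n).Finite := Set.finite_range _

theorem I_pow_smul_pauli_mem (k : ℕ) (p q : Bits n) :
    Complex.I ^ k • pauli p q ∈ pauliSet n :=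
  ⟨(⟨k % 4, Nat.mod_lt _ (by norm_num)⟩, p, q), by simp [← Complex.I_pow_eq_pow_mod]⟩

theorem smul_mem_pauliSet {Q : QMat n} (hQ : Q ∈ pauliSet n) (k : ℕ) :
    Complex.I ^ k • Q ∈ pauliSet n := by
  obtain ⟨x, rfl⟩ := hQ
  simp only [smul_smul, ← pow_add]
  exact I_pow_smul_pauli_mem _ _ _

theorem exists_sgn_eq_I_pow (z : ZMod 2) : ∃ k : ℕ, sgn z = Complex.I ^ k := by
  rcases zmod_two_cases z with rfl | rfl
  · exact ⟨0, by simp⟩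
  · exact ⟨2, by simp⟩

theorem mem_pauliSet_of_apply {A : QMat n} (k : ℕ) (p q : Bits n)
    (h : ∀ a b, A a b = if a = b + p then Complex.I ^ k * sgn (q ⬝ᵥ b) else 0) :
    A ∈ pauliSet n := by
  convert I_pow_smul_pauli_mem k p q
  ext a b
  simp [h, pauli]

theorem bits_add_self (a : Bits n) : a + a = 0 :=
  funext fun i => CharTwo.add_self_eq_zero (a i)

theorem bits_add_eq_zero {a b : Bits n} : a + b = 0 ↔ a = b := by
  constructor
  · intro h
    rw [← add_zero a, ← bits_add_self b, ← add_assoc, h, zero_add]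
  · rintro rfl; exact bits_add_self a

theorem dotProduct_update (q b : Bits n) (j : Fin n) (u : ZMod 2) :
    q ⬝ᵥ Function.update b j u = q ⬝ᵥ b + q j * (u + b j) := by
  have : Function.update b j u = b + Pi.single j (u + b j) := by
    ext i
    by_cases hi : i = j
    · subst hi
      simp only [Function.update_self, Pi.add_apply, Pi.single_eq_same]
      rw [add_comm u, ← add_assoc, CharTwo.add_self_eq_zero, zero_add]
    · simp [hi]
  rw [this, dotProduct_add, dotProduct_single]

theorem update_dotProduct_eq (q b : Bits n) (j : Fin n) (u : ZMod 2) :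
    Function.update q j u ⬝ᵥ b = q ⬝ᵥ b + (u + q j) * b j := by
  rw [dotProduct_comm, dotProduct_update, dotProduct_comm, mul_comm]

/-- Conjugation exchanges `X` and `Z` on qubit `j`; reordering `ZX` as `XZ` costs the sign `(-1)^(p
j * q j)`. -/
theorem conj_hadamardGate_pauli_mem (j : Fin n) (p q : Bits n) :
    hadamardGate j * pauli p q * (hadamardGate j)ᴴ ∈ pauliSet n := by
  obtain ⟨k, hk⟩ := exists_sgn_eq_I_pow (p j * q j)
  refine mem_pauliSet_of_apply k (Function.update p j (q j)) (Function.update q j (p j)) ?_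
  intro a b
  rw [conj_hadamardGate_apply, ← hk]
  by_cases h : ∀ i, i ≠ j → a i = b i + p i
  · have h1 : ∀ u v, Function.update a j u = Function.update b j v + p ↔ u = v + p j := by
      intro u v
      constructor
      · intro H; simpa using congrFun H j
      · rintro rfl; ext i
        by_cases hi : i = j
        · subst hi; simp
        · simp [hi, h i hi]
    have h2 : a = b + Function.update p j (q j) ↔ a j = b j + q j := by
      constructor
      · intro H; simpa using congrFun H j
      · intro H; ext i
        by_cases hi : i = j
        · subst hi; simp [H]
        · simp [hi, h i hi]
    simp only [pauli, Matrix.of_apply, h1, h2, dotProduct_update, update_dotProduct_eq, sum_zmod_two,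
      sgn_add]
    generalize a j = x, b j = y, p j = z, q j = w, q ⬝ᵥ b = r
    have h11 : (1 : ZMod 2) + 1 = 0 := by decide
    rcases zmod_two_cases x with rfl | rfl <;> rcases zmod_two_cases y with rfl | rfl <;>
      rcases zmod_two_cases z with rfl | rfl <;> rcases zmod_two_cases w with rfl | rfl <;>
      simp [h11] <;> ring
  · have h1 : ∀ u v, Function.update a j u ≠ Function.update b j v + p := by
      intro u v H
      refine h fun i hi => ?_
      simpa [hi] using congrFun H i
    have h2 : a ≠ b + Function.update p j (q j) := by
      intro H
      refine h fun i hi => ?_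
      simpa [hi] using congrFun H i
    simp [pauli, h1, h2]

/-- Conjugation fixes `Z` and sends `X` to `iXZ` on qubit `j`. -/
theorem conj_phaseGate_pauli_mem (j : Fin n) (p q : Bits n) :
    phaseGate j * pauli p q * (phaseGate j)ᴴ ∈ pauliSet n := by
  refine mem_pauliSet_of_apply (p j).val p (Function.update q j (q j + p j)) ?_
  intro a b
  rw [conj_phaseGate_apply]
  simp only [pauli, Matrix.of_apply]
  split_ifs with h
  · have h := congrFun h j
    simp only [Pi.add_apply] at h
    rw [update_dotProduct_eq, sgn_add, h]
    have h11 : (1 : ZMod 2) + 1 = 0 := by decide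
    generalize p j = x, b j = y, q j = z
    rcases zmod_two_cases x with rfl | rfl <;> rcases zmod_two_cases y with rfl | rfl <;>
      rcases zmod_two_cases z with rfl | rfl <;> simp [h11, phase, ZMod.val_one] <;>
      ring_nf <;> simp
  · simp

theorem cnotMap_add (c t : Fin n) (a b : Bits n) :
    cnotMap c t (a + b) = cnotMap c t a + cnotMap c t b := by
  ext i
  by_cases hi : i = t
  · subst hi; simp [cnotMap]; ring
  · simp [cnotMap, hi]

/-- The `X` part moves by the CNOT map, the `Z` part by its transpose, which exchanges control and
target. -/
theorem conj_cnotGate_pauli_mem {c t : Fin n} (h : c ≠ t) (p q : Bits n) :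
    cnotGate c t * pauli p q * (cnotGate c t)ᴴ ∈ pauliSet n := by
  refine mem_pauliSet_of_apply 0 (cnotMap c t p) (cnotMap t c q) ?_
  intro a b
  rw [conj_cnotGate_apply h]
  simp only [pauli, Matrix.of_apply]
  have h1 : cnotMap c t a = cnotMap c t b + p ↔ a = b + cnotMap c t p := by
    constructor
    · intro H
      rw [← cnotMap_cnotMap h a, H, cnotMap_add, cnotMap_cnotMap h]
    · intro H
      rw [H, cnotMap_add, cnotMap_cnotMap h]
  have h2 : q ⬝ᵥ cnotMap c t b = cnotMap t c q ⬝ᵥ b := by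
    rw [cnotMap, cnotMap, dotProduct_update, update_dotProduct_eq,
      add_right_comm, CharTwo.add_self_eq_zero, add_right_comm, CharTwo.add_self_eq_zero]
    simp
  simp [h1, h2]

theorem conj_mem_pauliSet {U : Matrix.unitaryGroup (Bits n) ℂ} (hU : U ∈ cliffordGroup n) :
    ∀ Q ∈ pauliSet n, (U : QMat n) * Q * (U : QMat n)ᴴ ∈ pauliSet n := by
  induction hU using Subgroup.closure_induction with
  | mem U hU =>
    rintro _ ⟨x, rfl⟩
    simp only [Matrix.mul_smul, Matrix.smul_mul]
    apply smul_mem_pauliSet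
    rcases hU with ⟨j, h⟩ | ⟨j, h⟩ | ⟨c, t, hct, h⟩ <;> rw [h]
    · exact conj_hadamardGate_pauli_mem _ _ _
    · exact conj_phaseGate_pauli_mem _ _ _
    · exact conj_cnotGate_pauli_mem hct _ _
  | one => intro Q hQ; simpa using hQ
  | mul U V _ _ hU hV =>
    intro Q hQ
    have := hU _ (hV Q hQ)
    simpa [Matrix.conjTranspose_mul, mul_assoc] using this
  | inv U _ hU =>
    have hUU : (U : QMat n)ᴴ * (U : QMat n) = 1 := Matrix.mem_unitaryGroup_iff'.1 U.2
    -- An injective self-map of a finite set is onto, so the inverse conjugation preserves the set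
    -- too.
    have hinj : Set.InjOn (fun Q : QMat n => (U : QMat n) * Q * (U : QMat n)ᴴ) (pauliSet n) := by
      intro Q _ R _ h
      have := congrArg (fun A => (U : QMat n)ᴴ * A * (U : QMat n)) h
      simp only [mul_assoc, hUU, mul_one] at this
      simpa only [← mul_assoc, hUU, one_mul] using this
    have hsurj := ((pauliSet_finite.injOn_iff_bijOn_of_mapsTo hU).1 hinj).surjOn
    intro Q hQ
    obtain ⟨R, hR, rfl⟩ := hsurj hQ
    have : ((U⁻¹ : Matrix.unitaryGroup (Bits n) ℂ) : QMat n) = (U : QMat n)ᴴ := rfl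
    rw [this, Matrix.conjTranspose_conjTranspose]
    simp only [mul_assoc, hUU, mul_one]
    simpa only [← mul_assoc, hUU, one_mul] using hR

theorem trace_pauli_mul (p q : Bits n) (A : QMat n) :
    (pauli p q * A).trace = ∑ b, sgn (q ⬝ᵥ b) * A b (b + p) := by
  simp only [Matrix.trace, Matrix.diag_apply, Matrix.mul_apply, pauli, Matrix.of_apply]
  rw [Finset.sum_comm]
  simp

/-- Summing the Pauli coefficients against characters in `q` isolates a single matrix entry. -/
theorem ext_of_trace_pauli_mul {A B : QMat n}
    (h : ∀ p q : Bits n, (pauli p q * A).trace = (pauli p q * B).trace) : A = B := by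
  have key : ∀ (A : QMat n) (c p : Bits n),
      ∑ q, sgn (q ⬝ᵥ c) * (pauli p q * A).trace = 2 ^ n * A c (c + p) := by
    intro A c p
    simp only [trace_pauli_mul, Finset.mul_sum, ← mul_assoc, ← sgn_add, ← dotProduct_add]
    rw [Finset.sum_comm]
    simp only [← Finset.sum_mul, sum_sgn_dotProduct, bits_add_eq_zero]
    simp
  ext a b
  have h1 := key A a (a + b)
  have h2 := key B a (a + b)
  simp only [h] at h1
  rw [h1, ← add_assoc, bits_add_self, zero_add] at h2
  exact mul_left_cancel₀ (by positivity) h2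

theorem trace_pauli_mul_mem {P : QMat n} (hP : P ∈ stabilizerProjectors n) {Q : QMat n}
    (hQ : Q ∈ pauliSet n) :
    (Q * P).trace ∈ ⋃ b : Bits n, (fun R : QMat n => R b b) '' pauliSet n := by
  obtain ⟨C, hC, b, rfl⟩ := hP
  refine Set.mem_iUnion.2 ⟨b, (C : QMat n)ᴴ * Q * (C : QMat n), ?_, ?_⟩
  · have := conj_mem_pauliSet (inv_mem hC) Q hQ
    simpa [Matrix.star_eq_conjTranspose] using this
  · rw [← mul_assoc, Matrix.trace_mul_comm, ← mul_assoc, ← mul_assoc,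
      Matrix.trace_mul_comm, Matrix.trace_single_mul]
    simp

/-- A projector is determined by its Pauli coefficients, and each of these is a diagonal entry of
the Pauli matrix `Cᴴ Q C`, hence one of finitely many numbers. -/
theorem stabilizerProjectors_finite : (stabilizerProjectors n).Finite := by
  have hfin : (⋃ b : Bits n, (fun R : QMat n => R b b) '' pauliSet n).Finite :=
    Set.finite_iUnion fun b => pauliSet_finite.image _
  refine Set.Finite.of_finite_image (f := fun (A : QMat n) (x : Bits n × Bits n) =>
    (pauli x.1 x.2 * A).trace) ((Set.Finite.pi' fun _ => hfin).subset ?_) ?_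
  · rintro _ ⟨P, hP, rfl⟩ x
    exact trace_pauli_mul_mem hP (by simpa using I_pow_smul_pauli_mem 0 x.1 x.2)
  · intro A _ B _ h
    exact ext_of_trace_pauli_mul fun p q => congrFun h (p, q)

theorem StabState.ext {s t : StabState n} (h : s.proj = t.proj) : s = t := by
  cases s; cases t; simpa using h

instance : Finite (StabState n) := by
  have := (stabilizerProjectors_finite (n := n)).to_subtype
  exact Finite.of_injective (fun s : StabState n => (⟨s.proj, s.mem⟩ : stabilizerProjectors n))
    fun s t h => StabState.ext (congrArg Subtype.val h)

instance : Nonempty (StabState n) := ⟨⟨_, 1, one_mem _, 0, rfl⟩⟩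

noncomputable instance : Fintype (StabState n) := Fintype.ofFinite _

end Finiteness

/-! ### Symmetries and support of the third moment tensor. -/

section Moment

variable {n : ℕ}

/-- Conjugation by a Clifford unitary permutes the stabilizer states. -/
noncomputable def StabState.conj {U : Matrix.unitaryGroup (Bits n) ℂ} (hU : U ∈ cliffordGroup n) :
    StabState n ≃ StabState n :=
  have hmem : ∀ V ∈ cliffordGroup n, ∀ s : StabState n,
      (V : QMat n) * s.proj * (V : QMat n)ᴴ ∈ stabilizerProjectors n := by
    rintro V hV ⟨_, C, hC, b, rfl⟩
    refine ⟨V * C, mul_mem hV hC, b, ?_⟩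
    simp [Matrix.conjTranspose_mul, mul_assoc]
  have hUU : (U : QMat n)ᴴ * (U : QMat n) = 1 := Matrix.mem_unitaryGroup_iff'.1 U.2
  have hUU' : (U : QMat n) * (U : QMat n)ᴴ = 1 := Matrix.mem_unitaryGroup_iff.1 U.2
  { toFun := fun s => ⟨_, hmem U hU s⟩
    invFun := fun s => ⟨(U : QMat n)ᴴ * s.proj * (U : QMat n), by
      have := hmem U⁻¹ (inv_mem hU) s
      simpa [Matrix.star_eq_conjTranspose] using this⟩
    left_inv := fun s => StabState.ext (by
      simp only [mul_assoc, hUU, mul_one]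
      simp only [← mul_assoc, hUU, one_mul])
    right_inv := fun s => StabState.ext (by
      simp only [mul_assoc, hUU', mul_one]
      simp only [← mul_assoc, hUU', one_mul]) }

theorem StabState.exists_amplitudes (s : StabState n) :
    ∃ ψ : Bits n → ℂ, ∀ a b, s.proj a b = ψ a * star (ψ b) := by
  obtain ⟨_, C, hC, b₀, rfl⟩ := s
  refine ⟨fun a => (C : QMat n) a b₀, fun a b => ?_⟩
  simp [Matrix.mul_apply, Matrix.single, ite_and]

/-- The entries of `∑ₛ |s⟩⟨s| ⊗ |s⟩⟨s| ⊗ |s⟩⟨s|`, over all stabilizer states `s`. -/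
noncomputable def moment (x y : Fin 3 → Bits n) : ℂ :=
  ∑ s : StabState n, ∏ i, s.proj (x i) (y i)

/-- Each projector has rank one, so its entries split into amplitudes and columns can be permuted
independently of rows. -/
theorem moment_comp_right (x y : Fin 3 → Bits n) (π : Equiv.Perm (Fin 3)) :
    moment x (y ∘ π) = moment x y := by
  refine Finset.sum_congr rfl fun s _ => ?_
  obtain ⟨ψ, hψ⟩ := s.exists_amplitudes
  simp only [hψ, Finset.prod_mul_distrib, Function.comp_apply]
  rw [Equiv.prod_comp π (fun i => star (ψ (y i)))]

theorem moment_comp_left (x y : Fin 3 → Bits n) (π : Equiv.Perm (Fin 3)) :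
    moment (x ∘ π) y = moment x y := by
  refine Finset.sum_congr rfl fun s _ => ?_
  obtain ⟨ψ, hψ⟩ := s.exists_amplitudes
  simp only [hψ, Finset.prod_mul_distrib, Function.comp_apply]
  rw [Equiv.prod_comp π (fun i => ψ (x i))]

theorem moment_conj {U : Matrix.unitaryGroup (Bits n) ℂ} (hU : U ∈ cliffordGroup n)
    (x y : Fin 3 → Bits n) :
    ∑ s : StabState n, ∏ i, ((U : QMat n) * s.proj * (U : QMat n)ᴴ) (x i) (y i) = moment x y :=
  (StabState.conj hU).sum_comp fun s => ∏ i, s.proj (x i) (y i)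

theorem moment_phase (j : Fin n) (x y : Fin 3 → Bits n) :
    (∏ i, phase (x i j) * star (phase (y i j))) * moment x y = moment x y := by
  obtain ⟨U, hU, h⟩ := exists_phaseGate j
  conv_rhs => rw [← moment_conj hU]
  simp only [h, conj_phaseGate_apply, moment, Finset.mul_sum, ← Finset.prod_mul_distrib]
  refine Finset.sum_congr rfl fun s _ => Finset.prod_congr rfl fun i _ => ?_
  ring

theorem moment_cnotMap {c t : Fin n} (hct : c ≠ t) (x y : Fin 3 → Bits n) :
    moment (fun i => cnotMap c t (x i)) (fun i => cnotMap c t (y i)) = moment x y := by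
  obtain ⟨U, hU, h⟩ := exists_cnotGate hct
  rw [← moment_conj hU x y]
  simp only [h, conj_cnotGate_apply hct, moment]

theorem moment_hadamard (j : Fin n) (x y : Fin 3 → Bits n) :
    moment x y = 1 / 8 * ∑ u : Fin 3 → ZMod 2, ∑ v : Fin 3 → ZMod 2,
      (∏ i, sgn (x i j * u i) * sgn (y i j * v i)) *
        moment (fun i => Function.update (x i) j (u i)) (fun i => Function.update (y i) j (v i)) := by
  obtain ⟨U, hU, h⟩ := exists_hadamardGate j
  conv_lhs => rw [← moment_conj hU]
  simp only [h, conj_hadamardGate_apply, moment, Finset.prod_mul_distrib, Finset.prod_univ_sum,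
    Fintype.piFinset_univ]
  simp only [← Finset.mul_sum]
  congr 1
  · norm_num
  · rw [Finset.sum_comm]
    refine Finset.sum_congr rfl fun u _ => ?_
    rw [Finset.sum_comm]
    refine Finset.sum_congr rfl fun v _ => ?_
    rw [Finset.mul_sum]

/-- Over `F_2` invertible diagonal matrices are trivial and nontrivial transvections are CNOTs, so
CNOT invariance extends to all of `GL_n(F_2)`. -/
theorem moment_mulVec (A : Matrix (Fin n) (Fin n) (ZMod 2)) (hA : A.det ≠ 0) :
    ∀ x y : Fin 3 → Bits n,
      moment (fun i => A *ᵥ x i) (fun i => A *ᵥ y i) = moment x y := by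
  refine Matrix.diagonal_transvection_induction_of_det_ne_zero (fun A => ∀ x y : Fin 3 → Bits n,
      moment (fun i => A *ᵥ x i) (fun i => A *ᵥ y i) = moment x y) A hA ?_ ?_ ?_
  · intro D hD x y
    have : D = fun _ => 1 := by
      ext i
      refine (zmod_two_cases (D i)).resolve_left fun h => hD ?_
      rw [Matrix.det_diagonal]
      exact Finset.prod_eq_zero (Finset.mem_univ i) h
    simp [this]
  · rintro ⟨i, j, hij, c⟩ x y
    rcases zmod_two_cases c with rfl | rfl
    · simp [Matrix.TransvectionStruct.toMatrix]
    · have : ∀ b : Bits n, Matrix.transvection i j (1 : ZMod 2) *ᵥ b = cnotMap j i b := by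
        intro b
        ext k
        rw [Matrix.transvection, Matrix.add_mulVec, Matrix.one_mulVec, Matrix.single_mulVec]
        by_cases hk : k = i
        · subst hk; simp [cnotMap]
        · simp [cnotMap, hk]
      simp only [Matrix.TransvectionStruct.toMatrix, this]
      exact moment_cnotMap hij.symm x y
  · intro A B _ _ hA hB x y
    simp only [← Matrix.mulVec_mulVec]
    rw [hA, hB]

/-- The linear map `b ↦ b + (l · b) v`. -/
def shear (l v b : Bits n) : Bits n := b + (l ⬝ᵥ b) • v

theorem shear_shear {l v : Bits n} (h : l ⬝ᵥ v = 0) (b : Bits n) :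
    shear l v (shear l v b) = b := by
  simp [shear, dotProduct_add, h, add_assoc, bits_add_self]

theorem shear_injective {l v : Bits n} (h : l ⬝ᵥ v = 0) : Function.Injective (shear l v) :=
  (show Function.LeftInverse (shear l v) (shear l v) from shear_shear h).injective

theorem moment_shear {l v : Bits n} (h : l ⬝ᵥ v = 0) (x y : Fin 3 → Bits n) :
    moment (fun i => shear l v (x i)) (fun i => shear l v (y i)) = moment x y := by
  have hA : ∀ b, (1 + Matrix.vecMulVec v l) *ᵥ b = shear l v b := by
    intro b
    rw [Matrix.add_mulVec, Matrix.one_mulVec, Matrix.vecMulVec_mulVec, shear]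
    ext i; simp
  have hAA : (1 + Matrix.vecMulVec v l) * (1 + Matrix.vecMulVec v l) = 1 := by
    refine Matrix.ext_of_mulVec_single fun i => ?_
    rw [← Matrix.mulVec_mulVec, hA, hA, shear_shear h, Matrix.one_mulVec]
  have hdet : (1 + Matrix.vecMulVec v l).det ≠ 0 := by
    intro h0
    have := congrArg Matrix.det hAA
    simp [h0] at this
  simpa only [hA] using moment_mulVec _ hdet x y

/-- The product is `i` to the difference of the numbers of ones. This difference lies between -3 and
3, so divisibility by 4 makes it zero; four copies would break this. -/
theorem sum_sgn_eq_of_prod_phase {x y : Fin 3 → ZMod 2}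
    (h : ∏ i, phase (x i) * star (phase (y i)) = 1) : ∑ i, sgn (x i) = ∑ i, sgn (y i) := by
  rw [Fin.prod_univ_three] at h
  rw [Fin.sum_univ_three, Fin.sum_univ_three]
  revert h
  rcases zmod_two_cases (x 0) with h0 | h0 <;> rcases zmod_two_cases (x 1) with h1 | h1 <;>
    rcases zmod_two_cases (x 2) with h2 | h2 <;> rcases zmod_two_cases (y 0) with h3 | h3 <;>
    rcases zmod_two_cases (y 1) with h4 | h4 <;> rcases zmod_two_cases (y 2) with h5 | h5 <;>
    simp [h0, h1, h2, h3, h4, h5, phase, sgn, Complex.ext_iff] <;> norm_num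

theorem sum_sgn_apply_eq {x y : Fin 3 → Bits n} (h : moment x y ≠ 0) (j : Fin n) :
    ∑ i, sgn (x i j) = ∑ i, sgn (y i j) :=
  sum_sgn_eq_of_prod_phase (mul_right_cancel₀ h ((moment_phase j x y).trans (one_mul _).symm))

/-- For `l ≠ 0` an invertible shear writes `l ⬝ᵥ b` into a coordinate `t` with `l t = 1`, which
reduces to the coordinate case. -/
theorem sum_sgn_dotProduct_eq {x y : Fin 3 → Bits n} (h : moment x y ≠ 0) (l : Bits n) :
    ∑ i, sgn (l ⬝ᵥ x i) = ∑ i, sgn (l ⬝ᵥ y i) := by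
  by_cases hl : l = 0
  · simp [hl]
  · obtain ⟨t, ht⟩ : ∃ t, l t ≠ 0 := by
      by_contra! H; exact hl (funext H)
    have ht : l t = 1 := (zmod_two_cases _).resolve_left ht
    have hv : (l + Pi.single t 1) ⬝ᵥ (Pi.single t 1 : Bits n) = 0 := by
      simp [ht, CharTwo.add_self_eq_zero]
    rw [← moment_shear hv] at h
    have hs : ∀ b : Bits n, shear (l + Pi.single t 1) (Pi.single t 1) b t = l ⬝ᵥ b := by
      intro b
      simp only [shear, add_dotProduct, single_dotProduct, one_mul, Pi.add_apply, Pi.smul_apply,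
        Pi.single_eq_same, smul_eq_mul, mul_one]
      rw [add_comm, add_assoc, CharTwo.add_self_eq_zero, add_zero]
    simpa only [hs] using sum_sgn_apply_eq h t

/-- All character sums of the two triples agree, so by Fourier inversion every label has the same
multiplicity in both. -/
theorem exists_perm_of_moment_ne_zero {x y : Fin 3 → Bits n} (h : moment x y ≠ 0) :
    ∃ π : Equiv.Perm (Fin 3), y = x ∘ π := by
  have hcount : ∀ (x : Fin 3 → Bits n) (z : Bits n),
      ∑ l, sgn (l ⬝ᵥ z) * ∑ i, sgn (l ⬝ᵥ x i) = 2 ^ n * (Fintype.card {i // x i = z} : ℂ) := by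
    intro x z
    simp only [Finset.mul_sum, ← sgn_add, ← dotProduct_add]
    rw [Finset.sum_comm]
    simp only [sum_sgn_dotProduct, bits_add_eq_zero, eq_comm (a := z)]
    rw [← Finset.sum_filter, Fintype.card_subtype]
    simp [mul_comm]
  have hcard : ∀ z, Fintype.card {i // y i = z} = Fintype.card {i // x i = z} := by
    intro z
    have h1 := hcount x z
    have h2 := hcount y z
    simp only [sum_sgn_dotProduct_eq h] at h1
    rw [h1] at h2
    exact_mod_cast (mul_left_cancel₀ (by positivity) h2).symm
  refine ⟨Equiv.ofFiberEquiv fun z => Fintype.equivOfCardEq (hcard z), ?_⟩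
  ext1 i
  exact (Equiv.ofFiberEquiv_map _ i).symm

/-! ### Factorization of the moment tensor and invariance of the weight. -/

/-- The number of permutations of the positions that take `x` to `y`. -/
def permCount (x y : Fin 3 → Bits n) : ℕ :=
  (Finset.univ.filter fun π : Equiv.Perm (Fin 3) => y = x ∘ π).card

theorem permCount_comp_right (x y : Fin 3 → Bits n) (π : Equiv.Perm (Fin 3)) :
    permCount x (y ∘ π) = permCount x y := by
  refine Finset.card_bij (fun σ _ => σ * π⁻¹) ?_ ?_ ?_
  · intro σ hσ
    simp only [Finset.mem_filter, Finset.mem_univ, true_and] at hσ ⊢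
    ext1 i
    simpa using congrFun hσ (π⁻¹ i)
  · intro σ _ τ _ h
    exact mul_right_cancel h
  · intro σ hσ
    simp only [Finset.mem_filter, Finset.mem_univ, true_and] at hσ
    refine ⟨σ * π, ?_, by simp⟩
    simp [hσ, Function.comp_assoc]

theorem permCount_comp_left (x y : Fin 3 → Bits n) (π : Equiv.Perm (Fin 3)) :
    permCount (x ∘ π) y = permCount x y := by
  refine Finset.card_bij (fun σ _ => π * σ) ?_ ?_ ?_
  · intro σ hσ
    simpa [Function.comp_assoc] using hσ
  · intro σ _ τ _ h
    exact mul_left_cancel h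
  · intro σ hσ
    simp only [Finset.mem_filter, Finset.mem_univ, true_and] at hσ
    refine ⟨π⁻¹ * σ, ?_, by simp⟩
    simp only [Finset.mem_filter, Finset.mem_univ, true_and]
    ext1 i
    simp [hσ]

theorem permCount_comp_injective {g : Bits n → Bits n} (hg : Function.Injective g)
    (x y : Fin 3 → Bits n) :
    permCount (fun i => g (x i)) (fun i => g (y i)) = permCount x y := by
  unfold permCount
  congr 1
  ext π
  simp only [Finset.mem_filter, Finset.mem_univ, true_and]
  exact ⟨fun h => funext fun i => hg (congrFun h i), fun h => funext fun i => by simp [h]⟩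

theorem permCount_self_ne_zero (x : Fin 3 → Bits n) : (permCount x x : ℂ) ≠ 0 := by
  refine Nat.cast_ne_zero.2 (Finset.card_pos.2 ⟨1, ?_⟩).ne'
  simp

/-- The common ratio of `moment x y` and `permCount x y`. -/
noncomputable def weight (x : Fin 3 → Bits n) : ℂ := moment x x / permCount x x

theorem moment_eq_weight_mul (x y : Fin 3 → Bits n) :
    moment x y = weight x * permCount x y := by
  by_cases h : ∃ π : Equiv.Perm (Fin 3), y = x ∘ π
  · obtain ⟨π, rfl⟩ := h
    rw [moment_comp_right, permCount_comp_right, weight, div_mul_cancel₀]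
    exact permCount_self_ne_zero x
  · have h1 : permCount x y = 0 := by
      rw [permCount, Finset.card_eq_zero, Finset.filter_eq_empty_iff]
      exact fun π _ hπ => h ⟨π, hπ⟩
    rw [h1, Nat.cast_zero, mul_zero]
    by_contra h2
    exact h (exists_perm_of_moment_ne_zero h2)

theorem weight_comp (x : Fin 3 → Bits n) (π : Equiv.Perm (Fin 3)) :
    weight (x ∘ π) = weight x := by
  rw [weight, weight, moment_comp_left, moment_comp_right, permCount_comp_left,
    permCount_comp_right]

theorem weight_shear {l v : Bits n} (h : l ⬝ᵥ v = 0) (x : Fin 3 → Bits n) :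
    weight (fun i => shear l v (x i)) = weight x := by
  rw [weight, weight, moment_shear h, permCount_comp_injective (shear_injective h)]

/-- The shift is conjugation by the Pauli matrix `X = HZH`. In the Hadamard expansion it contributes
the signs of all `u i` and `v i`, which cancel because `v` permutes `u` in every nonzero term. -/
theorem moment_add_single (j : Fin n) (x y : Fin 3 → Bits n) :
    moment (fun i => x i + Pi.single j 1) (fun i => y i + Pi.single j 1) = moment x y := by
  rw [moment_hadamard j, moment_hadamard j x y]
  congr 1
  refine Finset.sum_congr rfl fun u _ => Finset.sum_congr rfl fun v _ => ?_
  have hu : ∀ (b : Bits n) (w : ZMod 2),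
      Function.update (b + Pi.single j 1) j w = Function.update b j w := by
    intro b w
    ext i
    by_cases hi : i = j
    · subst hi; simp
    · simp [hi]
  simp only [hu]
  by_cases h : moment (fun i => Function.update (x i) j (u i))
      (fun i => Function.update (y i) j (v i)) = 0
  · simp [h]
  · obtain ⟨π, hπ⟩ := exists_perm_of_moment_ne_zero h
    have hv : ∀ i, v i = u (π i) := fun i => by simpa using congrFun (congrFun hπ i) j
    congr 1
    simp only [Pi.add_apply, Pi.single_eq_same, add_mul, one_mul, sgn_add, Finset.prod_mul_distrib,
      hv]
    rw [Equiv.prod_comp π (fun i => sgn (u i))]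
    have hp : (∏ i, sgn (u i)) * ∏ i, sgn (u i) = 1 := by
      rw [← Finset.prod_mul_distrib]
      exact Finset.prod_eq_one fun i _ => sgn_mul_self _
    linear_combination ((∏ i, sgn (x i j * u i)) * ∏ i, sgn (y i j * u (π i))) * hp

theorem weight_add_single (j : Fin n) (x : Fin 3 → Bits n) :
    weight (fun i => x i + Pi.single j 1) = weight x := by
  rw [weight, weight, moment_add_single, permCount_comp_injective (add_left_injective _)]

theorem weight_add (c : Bits n) (x : Fin 3 → Bits n) :
    weight (fun i => x i + c) = weight x := by
  have : c = ∑ j, Pi.single j (c j) := (Finset.univ_sum_single c).symm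
  rw [this]
  refine Finset.sum_induction _ (fun c : Bits n => ∀ x : Fin 3 → Bits n,
    weight (fun i => x i + c) = weight x) ?_ ?_ ?_ x
  · intro a b ha hb x
    simp only [← add_assoc]
    rw [hb, ha]
  · simp
  · intro j _ x
    rcases zmod_two_cases (c j) with h | h <;> rw [h]
    · simp
    · exact weight_add_single j x

/-- On the diagonal of the Hadamard identity, vanishing `j`-th bits make all signs 1. For each `u`,
every permutation fixing `x` matches exactly one `v`, so the factor `permCount x x` cancels. -/
theorem weight_eq_mean {j : Fin n} {x : Fin 3 → Bits n} (hx : ∀ i, x i j = 0) :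
    8 * weight x = ∑ u : Fin 3 → ZMod 2, weight fun i => Function.update (x i) j (u i) := by
  have h := moment_hadamard j x x
  simp only [hx, zero_mul, sgn_zero, mul_one, Finset.prod_const_one, one_mul,
    moment_eq_weight_mul] at h
  have hcount : ∀ u : Fin 3 → ZMod 2, ∑ v : Fin 3 → ZMod 2,
      permCount (fun i => Function.update (x i) j (u i))
        (fun i => Function.update (x i) j (v i)) = permCount x x := by
    intro u
    simp only [permCount, Finset.card_filter]
    rw [Finset.sum_comm]
    refine Finset.sum_congr rfl fun π _ => ?_
    have hiff : ∀ v : Fin 3 → ZMod 2, (fun i => Function.update (x i) j (v i)) =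
        (fun i => Function.update (x i) j (u i)) ∘ π ↔ x = x ∘ π ∧ v = u ∘ π := by
      intro v
      constructor
      · intro H
        constructor
        · ext i k
          by_cases hk : k = j
          · subst hk; simp [hx]
          · simpa [hk] using congrFun (congrFun H i) k
        · ext1 i
          simpa using congrFun (congrFun H i) j
      · rintro ⟨h1, rfl⟩
        ext1 i
        have := congrFun h1 i
        simp only [Function.comp_apply] at this
        simp [this]
    simp only [hiff, ite_and]
    split_ifs <;> simp
  have hc := permCount_self_ne_zero x
  simp only [← Finset.mul_sum, ← Nat.cast_sum, hcount, ← Finset.sum_mul] at h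
  refine mul_right_cancel₀ hc ?_
  linear_combination 8 * h

end Moment

/-! ### The weight is constant, and the 3-design identity. -/

section Design

variable {n : ℕ}

theorem sum_fin_three_arrow {α β : Type*} [Fintype α] [AddCommMonoid β] (F : (Fin 3 → α) → β) :
    ∑ u, F u = ∑ a, ∑ b, ∑ c, F ![a, b, c] := by
  classical
  let e : α × α × α ≃ (Fin 3 → α) :=
    { toFun := fun p => ![p.1, p.2.1, p.2.2]
      invFun := fun u => (u 0, u 1, u 2)
      left_inv := fun p => rfl
      right_inv := fun u => by ext i; fin_cases i <;> rfl }
  rw [← e.sum_comp, Fintype.sum_prod_type]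
  refine Finset.sum_congr rfl fun a _ => ?_
  rw [Fintype.sum_prod_type]
  rfl

theorem weight_vec_add (p q r c : Bits n) :
    weight ![p + c, q + c, r + c] = weight ![p, q, r] := by
  rw [← weight_add c ![p, q, r]]
  congr 1; ext1 i; fin_cases i <;> rfl

theorem weight_vec_shear {l v : Bits n} (h : l ⬝ᵥ v = 0) (p q r : Bits n) :
    weight ![shear l v p, shear l v q, shear l v r] = weight ![p, q, r] := by
  rw [← weight_shear h ![p, q, r]]
  congr 1; ext1 i; fin_cases i <;> rfl

theorem weight_vec_swap_right (p q r : Bits n) : weight ![p, r, q] = weight ![p, q, r] := by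
  rw [← weight_comp ![p, q, r] (Equiv.swap 1 2)]
  congr 1; ext1 i; fin_cases i <;> rfl

theorem weight_vec_swap_left (p q r : Bits n) : weight ![q, p, r] = weight ![p, q, r] := by
  rw [← weight_comp ![p, q, r] (Equiv.swap 0 1)]
  congr 1; ext1 i; fin_cases i <;> rfl

theorem weight_vec_eq_mean {j : Fin n} {p q r : Bits n} (hp : p j = 0) (hq : q j = 0)
    (hr : r j = 0) :
    8 * weight ![p, q, r] = ∑ a, ∑ b, ∑ c,
      weight ![p + Pi.single j a, q + Pi.single j b, r + Pi.single j c] := by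
  rw [weight_eq_mean (j := j) (by intro i; fin_cases i <;> assumption), sum_fin_three_arrow]
  have hupd : ∀ (b : Bits n) (u : ZMod 2), b j = 0 →
      Function.update b j u = b + Pi.single j u := by
    intro b u hb
    ext i
    by_cases hi : i = j
    · subst hi; simp [hb]
    · simp [hi]
  refine Finset.sum_congr rfl fun a _ => Finset.sum_congr rfl fun b _ =>
    Finset.sum_congr rfl fun c _ => ?_
  rw [← hupd p a hp, ← hupd q b hq, ← hupd r c hr]
  congr 1; ext1 i; fin_cases i <;> rfl

theorem shear_single_self {j : Fin n} {w : Bits n} (hj : w j = 1) :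
    (Pi.single j 1 : Bits n) ⬝ᵥ (w + Pi.single j 1) = 0 ∧
      shear (Pi.single j 1) (w + Pi.single j 1) w = Pi.single j 1 := by
  constructor
  · simp [hj, CharTwo.add_self_eq_zero]
  · simp [shear, hj, ← add_assoc, bits_add_self]

theorem exists_apply_eq_one {w : Bits n} (hw : w ≠ 0) : ∃ j, w j = 1 := by
  obtain ⟨j, hj⟩ : ∃ j, w j ≠ 0 := by
    by_contra! H; exact hw (funext H)
  exact ⟨j, (zmod_two_cases _).resolve_left hj⟩

theorem shear_zero (l v : Bits n) : shear l v 0 = 0 := by simp [shear]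

/-- A shear takes a nonzero `w` to a basis vector `e`. In the mean-value identity at `(0, 0, 0)`,
two terms are constant triples and six are equivalent to `(0, 0, e)`. -/
theorem weight_pair (w : Bits n) : weight ![0, 0, w] = weight ![(0 : Bits n), 0, 0] := by
  by_cases hw : w = 0
  · rw [hw]
  obtain ⟨j, hj⟩ := exists_apply_eq_one hw
  obtain ⟨h1, h2⟩ := shear_single_self hj
  rw [← weight_vec_shear h1, shear_zero, h2]
  have hm := weight_vec_eq_mean (j := j) (p := 0) (q := 0) (r := 0) rfl rfl rfl
  simp only [sum_zmod_two, zero_add, Pi.single_zero] at hm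
  set e : Bits n := Pi.single j 1
  have h3 : weight ![e, e, 0] = weight ![0, 0, e] := by
    rw [← weight_vec_add 0 0 e e]; simp [bits_add_self]
  have h4 : weight ![e, e, e] = weight ![(0 : Bits n), 0, 0] := by
    rw [← weight_vec_add 0 0 0 e]; simp
  have h5 : weight ![e, 0, e] = weight ![0, 0, e] := by
    rw [weight_vec_swap_right, h3]
  have h6 : weight ![0, e, e] = weight ![0, 0, e] := by
    rw [weight_vec_swap_left, h5]
  have h7 : weight ![0, e, 0] = weight ![0, 0, e] := weight_vec_swap_right _ _ _
  have h8 : weight ![e, 0, 0] = weight ![0, 0, e] := by rw [weight_vec_swap_left, h7]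
  rw [h3, h4, h5, h6, h7, h8] at hm
  linear_combination (-1 / 6 : ℂ) * hm

theorem weight_vec_self (p r : Bits n) : weight ![p, p, r] = weight ![(0 : Bits n), 0, 0] := by
  rw [← weight_vec_add p p r p, bits_add_self, weight_pair]

/-- In the mean-value identity at `(0, 0, z)`, four terms have equal first points. The other four
reduce to `(0, e, z)` by translating by `e` and by the shear that adds `e` when bit `k` is set. -/
theorem weight_distinct_of_apply_eq_zero {j k : Fin n} {z : Bits n} (hj : z j = 0) (hk : z k = 1) :
    weight ![0, Pi.single j 1, z] = weight ![(0 : Bits n), 0, 0] := by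
  have hkj : k ≠ j := by rintro rfl; simp [hj] at hk
  have hm := weight_vec_eq_mean (j := j) (p := 0) (q := 0) (r := z) rfl rfl hj
  simp only [sum_zmod_two, zero_add, Pi.single_zero, add_zero, weight_vec_self] at hm
  set e : Bits n := Pi.single j 1 with he
  have hkv : (Pi.single k 1 : Bits n) ⬝ᵥ e = 0 := by simp [he, hkj]
  have h1 : weight ![0, e, z + e] = weight ![0, e, z] := by
    rw [← weight_vec_shear hkv 0 e z]
    simp [shear, he, hkj, hk]
  have h2 : weight ![e, 0, z] = weight ![0, e, z] := by
    rw [← weight_vec_add, bits_add_self, zero_add, h1]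
  have h3 : weight ![e, 0, z + e] = weight ![0, e, z] := by
    rw [← weight_vec_add, bits_add_self, zero_add, add_assoc, bits_add_self, add_zero]
  rw [h1, h2, h3] at hm
  linear_combination (-1 / 4 : ℂ) * hm

/-- If two points coincide, `weight_vec_self` applies. Otherwise affine maps move the first point to
0 and the second to a basis vector, and clear that bit of the third. -/
theorem weight_eq_weight_zero (x : Fin 3 → Bits n) : weight x = weight ![(0 : Bits n), 0, 0] := by
  have hx : x = ![x 0, x 1, x 2] := by ext1 i; fin_cases i <;> rfl
  rw [hx]
  generalize x 0 = p, x 1 = q, x 2 = r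
  by_cases hpq : p = q
  · rw [hpq, weight_vec_self]
  by_cases hpr : p = r
  · rw [hpr, weight_vec_swap_right, weight_vec_self]
  by_cases hqr : q = r
  · rw [hqr, weight_vec_swap_left, weight_vec_swap_right, weight_vec_self]
  rw [← weight_vec_add p q r p, bits_add_self]
  obtain ⟨j, hj⟩ := exists_apply_eq_one (w := q + p) fun h => hpq (bits_add_eq_zero.1 h).symm
  obtain ⟨h1, h2⟩ := shear_single_self hj
  rw [← weight_vec_shear h1, shear_zero, h2]
  have hz0 : shear (Pi.single j 1) (q + p + Pi.single j 1) (r + p) ≠ 0 := by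
    intro h
    rw [← shear_zero] at h
    exact hpr (bits_add_eq_zero.1 (shear_injective h1 h)).symm
  have hz1 : shear (Pi.single j 1) (q + p + Pi.single j 1) (r + p) ≠ Pi.single j 1 := by
    intro h
    have h := h.trans h2.symm
    exact hqr (add_right_cancel (shear_injective h1 h)).symm
  revert hz0 hz1
  generalize shear (Pi.single j 1) (q + p + Pi.single j 1) (r + p) = z
  intro hz0 hz1
  rcases zmod_two_cases (z j) with h | h
  · obtain ⟨k, hk⟩ := exists_apply_eq_one hz0
    exact weight_distinct_of_apply_eq_zero h hk
  · obtain ⟨k, hk⟩ := exists_apply_eq_one (w := z + Pi.single j 1) fun h =>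
      hz1 (bits_add_eq_zero.1 h)
    have hkj : k ≠ j := by
      rintro rfl
      simp [h, CharTwo.add_self_eq_zero] at hk
    have hk' : z k = 1 := by simpa [hkj] using hk
    have hkv : (Pi.single k 1 : Bits n) ⬝ᵥ Pi.single j 1 = 0 := by simp [hkj]
    rw [← weight_vec_shear hkv, shear_zero]
    have h3 : shear (Pi.single k 1) (Pi.single j 1) (Pi.single j 1 : Bits n) = Pi.single j 1 := by
      simp [shear, hkj]
    have h4 : shear (Pi.single k 1) (Pi.single j 1) z = z + Pi.single j 1 := by
      simp [shear, hk']
    rw [h3, h4]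
    exact weight_distinct_of_apply_eq_zero (by simp [h, CharTwo.add_self_eq_zero]) hk

theorem trace_mul_eq_sum (A B : QMat n) : (A * B).trace = ∑ a, ∑ b, A b a * B a b := by
  rw [Finset.sum_comm]
  simp [Matrix.trace, Matrix.mul_apply]

theorem sum_perm_fin_three {β : Type*} [AddCommMonoid β] (F : Equiv.Perm (Fin 3) → β) :
    ∑ π, F π = F 1 + F (Equiv.swap 0 1) + F (Equiv.swap 0 2) + F (Equiv.swap 1 2) +
      F (finRotate 3) + F (finRotate 3)⁻¹ := by
  have : (Finset.univ : Finset (Equiv.Perm (Fin 3))) = {1, Equiv.swap 0 1, Equiv.swap 0 2,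
      Equiv.swap 1 2, finRotate 3, (finRotate 3)⁻¹} := by decide
  rw [this]
  repeat rw [Finset.sum_insert (by decide)]
  rw [Finset.sum_singleton]
  simp only [add_assoc]

/-- The trace of `A ⊗ B ⊗ C` on six times the projection onto the symmetric subspace. -/
def symTrace (A B C : QMat n) : ℂ :=
  A.trace * B.trace * C.trace + (A * B).trace * C.trace + (A * C).trace * B.trace +
    A.trace * (B * C).trace + (A * B * C).trace + (A * C * B).trace

/-- This pairs `A ⊗ B ⊗ C` with the moment tensor; each of the six permutations contributes a
product of traces over its cycles. -/
theorem sum_trace_mul_trace_mul_trace_eq (A B C : QMat n) :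
    ∑ s : StabState n, (A * s.proj).trace * (B * s.proj).trace * (C * s.proj).trace =
      weight ![(0 : Bits n), 0, 0] * symTrace A B C := by
  let D : Fin 3 → QMat n := ![A, B, C]
  have h1 : ∀ s : StabState n, (A * s.proj).trace * (B * s.proj).trace * (C * s.proj).trace =
      ∑ x : Fin 3 → Bits n, ∑ y : Fin 3 → Bits n,
        (∏ i, D i (y i) (x i)) * ∏ i, s.proj (x i) (y i) := by
    intro s
    have : (A * s.proj).trace * (B * s.proj).trace * (C * s.proj).trace =
        ∏ i, (D i * s.proj).trace := by
      rw [Fin.prod_univ_three]; rfl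
    rw [this]
    simp only [trace_mul_eq_sum, Finset.prod_univ_sum, Fintype.piFinset_univ,
      Finset.prod_mul_distrib]
  have h2 : ∑ s : StabState n, (A * s.proj).trace * (B * s.proj).trace * (C * s.proj).trace =
      ∑ x : Fin 3 → Bits n, ∑ y : Fin 3 → Bits n, (∏ i, D i (y i) (x i)) * moment x y := by
    simp only [h1, moment, Finset.mul_sum]
    rw [Finset.sum_comm]
    refine Finset.sum_congr rfl fun x _ => ?_
    rw [Finset.sum_comm]
  have h3 : ∀ x y : Fin 3 → Bits n, (permCount x y : ℂ) =
      ∑ π : Equiv.Perm (Fin 3), if y = x ∘ π then 1 else 0 := by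
    intro x y
    simp [permCount]
  have h4 : ∑ s : StabState n, (A * s.proj).trace * (B * s.proj).trace * (C * s.proj).trace =
      weight ![(0 : Bits n), 0, 0] *
        ∑ π : Equiv.Perm (Fin 3), ∑ x : Fin 3 → Bits n, ∏ i, D i (x (π i)) (x i) := by
    rw [h2, Finset.sum_comm (s := (Finset.univ : Finset (Equiv.Perm (Fin 3)))), Finset.mul_sum]
    refine Finset.sum_congr rfl fun x _ => ?_
    simp only [moment_eq_weight_mul, weight_eq_weight_zero x, h3, Finset.mul_sum]
    rw [Finset.sum_comm]
    refine Finset.sum_congr rfl fun π _ => ?_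
    simp [mul_comm]
  rw [h4]
  congr 1
  have e1 : (finRotate 3 : Equiv.Perm (Fin 3))⁻¹ 0 = 2 := by decide
  have e2 : (finRotate 3 : Equiv.Perm (Fin 3))⁻¹ 1 = 0 := by decide
  have e3 : (finRotate 3 : Equiv.Perm (Fin 3))⁻¹ 2 = 1 := by decide
  have e4 : (finRotate 3 : Equiv.Perm (Fin 3)) 0 = 1 := by decide
  have e5 : (finRotate 3 : Equiv.Perm (Fin 3)) 1 = 2 := by decide
  have e6 : (finRotate 3 : Equiv.Perm (Fin 3)) 2 = 0 := by decide
  have e7 : Equiv.swap (0 : Fin 3) 1 2 = 2 := by decide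
  have e8 : Equiv.swap (0 : Fin 3) 2 1 = 1 := by decide
  have e9 : Equiv.swap (1 : Fin 3) 2 0 = 0 := by decide
  simp only [sum_perm_fin_three, sum_fin_three_arrow, Fin.prod_univ_three, D, e1, e2, e3, e4, e5,
    e6, e7, e8, e9, Equiv.swap_apply_left, Equiv.swap_apply_right, Equiv.Perm.one_apply,
    Matrix.cons_val]
  have i1 : ∑ a, ∑ b, ∑ c, A a a * B b b * C c c = A.trace * B.trace * C.trace := by
    simp only [← Finset.mul_sum, ← Finset.sum_mul]
    rfl
  have i2 : ∑ a, ∑ b, ∑ c, A b a * B a b * C c c = (A * B).trace * C.trace := by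
    simp only [trace_mul_eq_sum, Finset.sum_mul]
    simp only [Matrix.trace, Matrix.diag_apply, Finset.mul_sum]
  have i3 : ∑ a, ∑ b, ∑ c, A c a * B b b * C a c = (A * C).trace * B.trace := by
    simp only [trace_mul_eq_sum, Finset.sum_mul]
    refine Finset.sum_congr rfl fun a _ => ?_
    rw [Finset.sum_comm]
    simp only [Matrix.trace, Matrix.diag_apply, Finset.mul_sum]
    refine Finset.sum_congr rfl fun b _ => Finset.sum_congr rfl fun c _ => ?_
    ring
  have i4 : ∑ a, ∑ b, ∑ c, A a a * B c b * C b c = A.trace * (B * C).trace := by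
    simp only [trace_mul_eq_sum, mul_assoc, ← Finset.mul_sum, ← Finset.sum_mul]
    rfl
  have i5 : ∑ a, ∑ b, ∑ c, A b a * B c b * C a c = (A * C * B).trace := by
    simp only [Matrix.trace, Matrix.diag_apply, Matrix.mul_apply, Finset.sum_mul]
    rw [Finset.sum_comm]
    refine Finset.sum_congr rfl fun b _ => ?_
    rw [Finset.sum_comm]
    refine Finset.sum_congr rfl fun c _ => Finset.sum_congr rfl fun a _ => ?_
    ring
  have i6 : ∑ a, ∑ b, ∑ c, A c a * B a b * C b c = (A * B * C).trace := by
    simp only [Matrix.trace, Matrix.diag_apply, Matrix.mul_apply, Finset.sum_mul]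
    rw [Finset.sum_congr rfl fun a _ => Finset.sum_comm, Finset.sum_comm]
    refine Finset.sum_congr rfl fun c _ => ?_
    rw [Finset.sum_comm]
  rw [i1, i2, i3, i4, i5, i6, symTrace]
  ring

theorem StabState.trace_proj (s : StabState n) : s.proj.trace = 1 := by
  obtain ⟨_, C, hC, b, rfl⟩ := s
  have hUU : (C : QMat n)ᴴ * (C : QMat n) = 1 := Matrix.mem_unitaryGroup_iff'.1 C.2
  change ((C : QMat n) * Matrix.single b b 1 * (C : QMat n)ᴴ).trace = 1
  rw [Matrix.trace_mul_comm, ← mul_assoc, hUU, one_mul]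
  simp

theorem trace_one_qMat : (1 : QMat n).trace = 2 ^ n := by
  simp [Matrix.trace_one]

/-- The stabilizer states form a complex projective 3-design. -/
theorem sum_trace_mul_trace_mul_trace (A B C : QMat n) :
    ∑ s : StabState n, (A * s.proj).trace * (B * s.proj).trace * (C * s.proj).trace =
      (Nat.card (StabState n) : ℂ) / (2 ^ n * (2 ^ n + 1) * (2 ^ n + 2)) * symTrace A B C := by
  -- Three identity matrices fix the constant: all overlaps are 1 and `symTrace` is `d(d+1)(d+2)`
  -- with `d = 2^n`.
  have h := sum_trace_mul_trace_mul_trace_eq (1 : QMat n) 1 1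
  have h0 : (2 : ℂ) ^ n * (2 ^ n + 1) * (2 ^ n + 2) ≠ 0 := by
    norm_cast; positivity
  simp only [one_mul, StabState.trace_proj, symTrace, mul_one, Finset.sum_const, trace_one_qMat,
    nsmul_eq_mul, Finset.card_univ, ← Nat.card_eq_fintype_card] at h
  rw [sum_trace_mul_trace_mul_trace_eq, h]
  congr 1
  rw [eq_div_iff h0]
  ring

end Design

/-! ### Mean and variance of the single-shot estimator. -/

section Statistics

open MeasureTheory ProbabilityTheory

variable {n : ℕ}

/-- The sum of the squared moduli of the entries of a matrix. -/
noncomputable def normSqSum (A : QMat n) : ℝ := ∑ i, ∑ j, ‖A i j‖ ^ 2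

theorem trace_mul_conjTranspose_re (A : QMat n) : (A * Aᴴ).trace.re = normSqSum A := by
  simp only [Matrix.trace, Matrix.diag_apply, Matrix.mul_apply, Matrix.conjTranspose_apply,
    Complex.re_sum, normSqSum]
  refine Finset.sum_congr rfl fun i _ => Finset.sum_congr rfl fun j _ => ?_
  rw [Complex.star_def, Complex.mul_conj, Complex.ofReal_re, Complex.normSq_eq_norm_sq]

theorem normSqSum_mul_le (A B : QMat n) : normSqSum (A * B) ≤ normSqSum A * normSqSum B := by
  have h : ∀ i j, ‖(A * B) i j‖ ^ 2 ≤ (∑ k, ‖A i k‖ ^ 2) * ∑ k, ‖B k j‖ ^ 2 := by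
    intro i j
    calc ‖(A * B) i j‖ ^ 2 ≤ (∑ k, ‖A i k‖ * ‖B k j‖) ^ 2 := by
          gcongr
          rw [Matrix.mul_apply]
          refine (norm_sum_le _ _).trans (Finset.sum_le_sum fun k _ => ?_)
          rw [norm_mul]
      _ ≤ _ := Finset.sum_mul_sq_le_sq_mul_sq _ _ _
  calc normSqSum (A * B) ≤ ∑ i, ∑ j, (∑ k, ‖A i k‖ ^ 2) * ∑ k, ‖B k j‖ ^ 2 :=
        Finset.sum_le_sum fun i _ => Finset.sum_le_sum fun j _ => h i j
    _ = _ := by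
        rw [← Finset.sum_mul_sum, normSqSum, normSqSum,
          Finset.sum_comm (f := fun k j => ‖B k j‖ ^ 2)]

open scoped MatrixOrder Matrix.Norms.L2Operator in
theorem exists_conjTranspose_mul_self {A : QMat n} (hA : A.PosSemidef) :
    ∃ B : QMat n, A = Bᴴ * B :=
  CStarAlgebra.nonneg_iff_eq_star_mul_self.mp hA.nonneg

/-- With `ρ = Bᴴ B` the left side is the squared Frobenius norm of `B * A`. This norm is
submultiplicative, and that of `B` is 1. -/
theorem trace_mul_mul_re_le {ρ : QMat n} (hρ : IsState ρ) {A : QMat n} (hA : A.IsHermitian) :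
    (A * A * ρ).trace.re ≤ (A * A).trace.re := by
  obtain ⟨B, hB⟩ := exists_conjTranspose_mul_self hρ.1
  have h1 : (A * A * ρ).trace.re = normSqSum (B * A) := by
    rw [← trace_mul_conjTranspose_re, Matrix.conjTranspose_mul, hA.eq, hB, ← mul_assoc,
      Matrix.trace_mul_comm]
    simp only [mul_assoc]
  have h2 : normSqSum B = 1 := by
    rw [← trace_mul_conjTranspose_re, Matrix.trace_mul_comm, ← hB, hρ.2, Complex.one_re]
  have h3 : (A * A).trace.re = normSqSum A := by
    rw [← trace_mul_conjTranspose_re, hA.eq]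
  rw [h1, h3]
  simpa [h2] using normSqSum_mul_le B A

theorem trace_mul_eq_ofReal {A B : QMat n} (hA : A.IsHermitian) (hB : B.IsHermitian) :
    (A * B).trace = ((A * B).trace.re : ℂ) := by
  refine (Complex.conj_eq_iff_re.1 ?_).symm
  rw [← Complex.star_def, ← Matrix.trace_conjTranspose, Matrix.conjTranspose_mul, hA.eq, hB.eq,
    Matrix.trace_mul_comm]

theorem trace_eq_ofReal {A : QMat n} (hA : A.IsHermitian) : A.trace = (A.trace.re : ℂ) := by
  simpa using trace_mul_eq_ofReal hA Matrix.isHermitian_one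

theorem StabState.isHermitian (s : StabState n) : s.proj.IsHermitian := by
  obtain ⟨ψ, hψ⟩ := s.exists_amplitudes
  ext a b
  simp [hψ, mul_comm]

theorem StabState.trace_mul_re_nonneg (s : StabState n) {ρ : QMat n} (hρ : ρ.PosSemidef) :
    0 ≤ (s.proj * ρ).trace.re := by
  obtain ⟨ψ, hψ⟩ := s.exists_amplitudes
  have h := hρ.re_dotProduct_nonneg ψ
  have : (s.proj * ρ).trace = star ψ ⬝ᵥ (ρ *ᵥ ψ) := by
    simp only [trace_mul_eq_sum, hψ, dotProduct, Matrix.mulVec, Pi.star_apply, Finset.mul_sum]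
    refine Finset.sum_congr rfl fun a _ => Finset.sum_congr rfl fun b _ => ?_
    ring
  rw [this]
  exact h

/-- The overlap `⟨s|A|s⟩`. -/
def overlap (A : QMat n) (s : StabState n) : ℝ := (A * s.proj).trace.re

theorem sum_overlap_mul_overlap_mul_overlap {A B C : QMat n} (hA : A.IsHermitian)
    (hB : B.IsHermitian) (hC : C.IsHermitian) :
    ∑ s : StabState n, overlap A s * overlap B s * overlap C s =
      (Nat.card (StabState n) : ℝ) / (2 ^ n * (2 ^ n + 1) * (2 ^ n + 2)) * (symTrace A B C).re := by
  have h := congrArg Complex.re (sum_trace_mul_trace_mul_trace A B C)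
  have hc : (Nat.card (StabState n) : ℂ) / (2 ^ n * (2 ^ n + 1) * (2 ^ n + 2)) =
      (((Nat.card (StabState n) : ℝ) / (2 ^ n * (2 ^ n + 1) * (2 ^ n + 2)) : ℝ) : ℂ) := by
    push_cast; rfl
  rw [hc, Complex.re_ofReal_mul] at h
  rw [← h, Complex.re_sum]
  refine Finset.sum_congr rfl fun s _ => ?_
  rw [trace_mul_eq_ofReal hA s.isHermitian, trace_mul_eq_ofReal hB s.isHermitian,
    trace_mul_eq_ofReal hC s.isHermitian, ← Complex.ofReal_mul, ← Complex.ofReal_mul,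
    Complex.ofReal_re]
  rfl

instance : DiscreteMeasurableSpace (StabState n) := ⟨fun _ => trivial⟩

theorem stabilizerMeasurement_singleton (ρ : QMat n) (s : StabState n) :
    stabilizerMeasurement ρ {s} =
      ENNReal.ofReal ((2 : ℝ) ^ n / (Nat.card (StabState n) : ℝ) * overlap ρ s) := by
  rw [stabilizerMeasurement, Measure.sum_apply _ .of_discrete, tsum_fintype,
    Finset.sum_eq_single s]
  · simp [overlap, Matrix.trace_mul_comm ρ]
  · intro t _ ht
    simp [ht]
  · simp

theorem overlap_nonneg {ρ : QMat n} (hρ : ρ.PosSemidef) (s : StabState n) : 0 ≤ overlap ρ s := by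
  rw [overlap, Matrix.trace_mul_comm]
  exact s.trace_mul_re_nonneg hρ

theorem overlap_one (s : StabState n) : overlap 1 s = 1 := by
  simp [overlap, s.trace_proj]

theorem card_stabState_pos : (0 : ℝ) < Nat.card (StabState n) :=
  Nat.cast_pos.2 Nat.card_pos

theorem isProbabilityMeasure_stabilizerMeasurement {ρ : QMat n} (hρ : IsState ρ) :
    IsProbabilityMeasure (stabilizerMeasurement ρ) := by
  constructor
  have h := sum_overlap_mul_overlap_mul_overlap (n := n) Matrix.isHermitian_one
    Matrix.isHermitian_one hρ.1.1
  simp only [overlap_one, one_mul, symTrace, hρ.2, trace_one_qMat, mul_one] at h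
  have h0 := card_stabState_pos (n := n)
  have h1 : ∑ s : StabState n, (2 : ℝ) ^ n / (Nat.card (StabState n) : ℝ) * overlap ρ s = 1 := by
    rw [← Finset.mul_sum, h]
    have : ((2 : ℂ) ^ n * 2 ^ n + 2 ^ n + 2 ^ n + 2 ^ n + 1 + 1).re =
        (2 : ℝ) ^ n * 2 ^ n + 2 ^ n + 2 ^ n + 2 ^ n + 1 + 1 := by
      norm_cast
    rw [this]
    field_simp
    ring
  rw [← Finset.coe_univ, ← sum_measure_singleton (s := (Finset.univ : Finset (StabState n)))]
  simp only [stabilizerMeasurement_singleton]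
  rw [← ENNReal.ofReal_sum_of_nonneg, h1, ENNReal.ofReal_one]
  intro s _
  have := overlap_nonneg hρ.1 s
  positivity

theorem integral_stabilizerMeasurement {ρ : QMat n} (hρ : IsState ρ) (f : StabState n → ℝ) :
    ∫ s, f s ∂stabilizerMeasurement ρ =
      (2 : ℝ) ^ n / (Nat.card (StabState n) : ℝ) * ∑ s, f s * overlap ρ s := by
  have := isProbabilityMeasure_stabilizerMeasurement hρ
  rw [integral_fintype .of_finite, Finset.mul_sum]
  refine Finset.sum_congr rfl fun s _ => ?_
  have := overlap_nonneg hρ.1 s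
  rw [measureReal_def, stabilizerMeasurement_singleton, ENNReal.toReal_ofReal (by positivity),
    smul_eq_mul]
  ring

/-- The single-shot estimator of `tr(A ρ)`. -/
def shot (A : QMat n) (s : StabState n) : ℝ := (2 ^ n + 1) * overlap A s - A.trace.re

theorem integral_overlap {ρ : QMat n} (hρ : IsState ρ) {A : QMat n} (hA : A.IsHermitian) :
    ∫ s, overlap A s ∂stabilizerMeasurement ρ =
      (A.trace.re + (A * ρ).trace.re) / (2 ^ n + 1) := by
  have h := sum_overlap_mul_overlap_mul_overlap hA (Matrix.isHermitian_one (n := Bits n)) hρ.1.1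
  have h0 := card_stabState_pos (n := n)
  simp only [overlap_one, mul_one, symTrace, hρ.2, trace_one_qMat, one_mul] at h
  have hs : (A.trace * 2 ^ n + A.trace + (A * ρ).trace * 2 ^ n + A.trace + (A * ρ).trace +
      (A * ρ).trace).re = (2 ^ n + 2) * (A.trace.re + (A * ρ).trace.re) := by
    rw [trace_eq_ofReal hA, trace_mul_eq_ofReal hA hρ.1.1]
    norm_cast
    push_cast
    ring
  rw [integral_stabilizerMeasurement hρ, h, hs]
  field_simp

theorem integral_shot {ρ : QMat n} (hρ : IsState ρ) {A : QMat n} (hA : A.IsHermitian) :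
    ∫ s, shot A s ∂stabilizerMeasurement ρ = (A * ρ).trace.re := by
  have := isProbabilityMeasure_stabilizerMeasurement hρ
  simp only [shot]
  rw [integral_sub .of_finite .of_finite, integral_const_mul, integral_overlap hρ hA]
  simp only [integral_const, probReal_univ, one_smul]
  field_simp
  ring

theorem integral_overlap_sq {ρ : QMat n} (hρ : IsState ρ) {A : QMat n} (hA : A.IsHermitian)
    (h0 : A.trace = 0) :
    ∫ s, overlap A s ^ 2 ∂stabilizerMeasurement ρ =
      ((A * A).trace.re + 2 * (A * A * ρ).trace.re) / ((2 ^ n + 1) * (2 ^ n + 2)) := by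
  have h := sum_overlap_mul_overlap_mul_overlap hA hA hρ.1.1
  have hc := card_stabState_pos (n := n)
  have hcyc : (A * ρ * A).trace = (A * A * ρ).trace := by
    rw [Matrix.trace_mul_comm, mul_assoc]
  simp only [symTrace, h0, hcyc, hρ.2, zero_mul, mul_one, mul_zero, zero_add, add_zero,
    Complex.add_re] at h
  rw [integral_stabilizerMeasurement hρ]
  simp only [pow_two (overlap A _)]
  rw [h]
  field_simp
  ring

/-- Subtracting from `A` its trace part only shifts the estimator by a constant and does not
increase `tr(A²)`. For traceless `A` the 3-design gives second moment at most `3 tr(A²) (d+1)/(d+2)`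
after rescaling, where `d = 2^n`. -/
theorem variance_shot_le {ρ : QMat n} (hρ : IsState ρ) {A : QMat n} (hA : A.IsHermitian) :
    Var[shot A; stabilizerMeasurement ρ] ≤ 3 * (A * A).trace.re := by
  have := isProbabilityMeasure_stabilizerMeasurement hρ
  set t : ℝ := A.trace.re / 2 ^ n with ht
  have htr : A.trace = ((2 ^ n * t : ℝ) : ℂ) := by
    rw [ht, mul_div_cancel₀ _ (by positivity), ← trace_eq_ofReal hA]
  set A₀ : QMat n := A - (t : ℂ) • 1 with hA₀
  have hH : A₀.IsHermitian := by
    rw [hA₀]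
    refine hA.sub ?_
    rw [Matrix.IsHermitian, Matrix.conjTranspose_smul]
    simp
  have h0 : A₀.trace = 0 := by
    rw [hA₀, Matrix.trace_sub, Matrix.trace_smul, trace_one_qMat, htr]
    push_cast
    simp [mul_comm]
  have hsq : (A₀ * A₀).trace.re ≤ (A * A).trace.re := by
    obtain ⟨r, hr⟩ : ∃ r : ℝ, (A * A).trace = (r : ℂ) := ⟨_, trace_mul_eq_ofReal hA hA⟩
    have h1 : (A₀ * A₀).trace = (r - 2 ^ n * t ^ 2 : ℝ) := by
      rw [hA₀]
      simp only [sub_mul, mul_sub, Matrix.trace_sub, Matrix.smul_mul, Matrix.mul_smul, one_mul,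
        mul_one, Matrix.trace_smul, trace_one_qMat, htr, hr, smul_eq_mul]
      push_cast
      ring
    rw [h1, hr, Complex.ofReal_re, Complex.ofReal_re]
    have : 0 ≤ 2 ^ n * t ^ 2 := by positivity
    linarith
  have hshot : shot A = fun s => (2 ^ n + 1) * overlap A₀ s + t := by
    ext s
    have : overlap A₀ s = overlap A s - t := by
      rw [overlap, hA₀, sub_mul, Matrix.trace_sub, Matrix.smul_mul, one_mul, Matrix.trace_smul,
        s.trace_proj]
      simp [overlap]
    rw [this, shot, htr, Complex.ofReal_re]
    ring
  have hmul : 0 ≤ (A₀ * A₀).trace.re := by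
    have := trace_mul_conjTranspose_re A₀
    rw [hH.eq] at this
    rw [this]
    unfold normSqSum
    positivity
  rw [hshot, variance_add_const (Measurable.of_discrete.aestronglyMeasurable), variance_const_mul]
  have hv : Var[overlap A₀; stabilizerMeasurement ρ] ≤
      3 * (A₀ * A₀).trace.re / ((2 ^ n + 1) * (2 ^ n + 2)) := by
    refine (variance_le_expectation_sq Measurable.of_discrete.aestronglyMeasurable).trans ?_
    have := integral_overlap_sq hρ hH h0
    simp only [Pi.pow_apply]
    rw [this]
    have := trace_mul_mul_re_le hρ hH
    gcongr
    linarith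
  calc _ ≤ ((2 : ℝ) ^ n + 1) ^ 2 * (3 * (A₀ * A₀).trace.re / ((2 ^ n + 1) * (2 ^ n + 2))) := by
        gcongr
    _ = 3 * (A₀ * A₀).trace.re * ((2 ^ n + 1) / (2 ^ n + 2)) := by field_simp
    _ ≤ 3 * (A₀ * A₀).trace.re * 1 := by
        gcongr
        rw [div_le_one (by positivity)]
        linarith
    _ ≤ _ := by linarith

end Statistics

/-! ### Median of means for independent samples. -/

section MedianOfMeans

open MeasureTheory ProbabilityTheory

/-- If the median is too large, so is every value from the upper middle position on; symmetrically
below. Either side has `⌈K/2⌉` positions. -/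
theorem card_deviating_of_median_deviates {K : ℕ} (hK : 0 < K) (v : Fin K → ℝ) (m ε : ℝ)
    (h : ε < |median v - m|) :
    (K + 1) / 2 ≤ (Finset.univ.filter fun k => ε < |v k - m|).card := by
  have hmono := Tuple.monotone_sort v
  set lo : Fin K := ⟨(K - 1) / 2, by omega⟩
  set hi : Fin K := ⟨K / 2, by omega⟩
  have hlohi : v (Tuple.sort v lo) ≤ v (Tuple.sort v hi) :=
    hmono (Fin.mk_le_mk.2 (by omega))
  have hmed : median v = (v (Tuple.sort v lo) + v (Tuple.sort v hi)) / 2 := by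
    rw [median, dif_pos hK]
  rcases lt_abs.1 h with h | h
  · calc (K + 1) / 2 ≤ (Finset.Ici hi).card := by
          rw [Fin.card_Ici]; simp only [hi]; omega
      _ ≤ _ := by
          refine Finset.card_le_card_of_injOn (Tuple.sort v) (fun i hi' => ?_)
            (Tuple.sort v).injective.injOn
          have h1 : v (Tuple.sort v hi) ≤ v (Tuple.sort v i) :=
            hmono (Finset.mem_Ici.1 (Finset.mem_coe.1 hi'))
          simp only [Finset.coe_filter, Finset.mem_univ, true_and, Set.mem_ofPred_eq]
          exact lt_abs.2 (Or.inl (by linarith))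
  · calc (K + 1) / 2 ≤ (Finset.Iic lo).card := by
          rw [Fin.card_Iic]; simp only [lo]; omega
      _ ≤ _ := by
          refine Finset.card_le_card_of_injOn (Tuple.sort v) (fun i hi' => ?_)
            (Tuple.sort v).injective.injOn
          have h1 : v (Tuple.sort v i) ≤ v (Tuple.sort v lo) :=
            hmono (Finset.mem_Iic.1 (Finset.mem_coe.1 hi'))
          simp only [Finset.coe_filter, Finset.mem_univ, true_and, Set.mem_ofPred_eq]
          exact lt_abs.2 (Or.inr (by linarith))

theorem measureReal_le_card_mem_le {Ω : Type*} [MeasurableSpace Ω] (P : Measure Ω)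
    [IsProbabilityMeasure P] {K : ℕ} (E : Fin K → Set Ω) {q : ℝ} (hq : 0 ≤ q)
    (hE : ∀ S : Finset (Fin K), P.real (⋂ k ∈ S, E k) ≤ q ^ S.card) (h : ℕ) (F : Set Ω)
    (hF : ∀ ω ∈ F, ∃ S : Finset (Fin K), h ≤ S.card ∧ ∀ k ∈ S, ω ∈ E k) :
    P.real F ≤ 2 ^ K * q ^ h := by
  have hsub : F ⊆ ⋃ S ∈ Finset.powersetCard h (Finset.univ : Finset (Fin K)), ⋂ k ∈ S, E k := by
    intro ω hω
    obtain ⟨S, hS, hmem⟩ := hF ω hω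
    obtain ⟨T, hTS, hT⟩ := Finset.exists_subset_card_eq hS
    simp only [Set.mem_iUnion, Set.mem_iInter]
    exact ⟨T, Finset.mem_powersetCard.2 ⟨Finset.subset_univ _, hT⟩, fun k hk => hmem k (hTS hk)⟩
  calc P.real F ≤ _ := measureReal_mono hsub (measure_ne_top _ _)
    _ ≤ ∑ S ∈ Finset.powersetCard h (Finset.univ : Finset (Fin K)), P.real (⋂ k ∈ S, E k) :=
        measureReal_biUnion_finset_le _ _
    _ ≤ ∑ S ∈ Finset.powersetCard h (Finset.univ : Finset (Fin K)), q ^ h := by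
        refine Finset.sum_le_sum fun S hS => ?_
        rw [← (Finset.mem_powersetCard.1 hS).2]
        exact hE S
    _ = (K.choose h : ℝ) * q ^ h := by
        rw [Finset.sum_const, Finset.card_powersetCard, Finset.card_univ, Fintype.card_fin,
          nsmul_eq_mul]
    _ ≤ 2 ^ K * q ^ h := by
        gcongr
        exact_mod_cast Nat.choose_le_two_pow K h

variable {Ω ι : Type*} [Fintype ι] [MeasurableSpace Ω]

/-- The event `E` only depends on the coordinates in `S`. -/
def DependsOnlyOn (E : Set (ι → Ω)) (S : Finset ι) : Prop :=
  ∀ s t : ι → Ω, (∀ j ∈ S, s j = t j) → s ∈ E → t ∈ E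

variable [Finite Ω] [DiscreteMeasurableSpace Ω] (μ : Measure Ω) [IsProbabilityMeasure μ]

/-- Such an event is the preimage of its own projection to the coordinates in `S`, measurable
because `Ω` is finite; disjoint coordinate blocks are independent. -/
theorem measureReal_inter_of_dependsOnlyOn {E F : Set (ι → Ω)} {S T : Finset ι}
    (hST : Disjoint S T) (hE : DependsOnlyOn E S) (hF : DependsOnlyOn F T) :
    (Measure.pi fun _ : ι => μ).real (E ∩ F) =
      (Measure.pi fun _ : ι => μ).real E * (Measure.pi fun _ : ι => μ).real F := by
  have hind := (iIndepFun_pi (μ := fun _ : ι => μ) (X := fun _ ω => ω)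
    (fun _ => aemeasurable_id)).indepFun_finset S T hST fun i => measurable_pi_apply i
  have hpre : ∀ {E : Set (ι → Ω)} {S : Finset ι}, DependsOnlyOn E S →
      (fun (s : ι → Ω) (i : S) => s i) ⁻¹' ((fun (s : ι → Ω) (i : S) => s i) '' E) = E := by
    intro E S hE
    refine Set.Subset.antisymm ?_ (Set.subset_preimage_image _ _)
    rintro t ⟨s, hs, hst⟩
    exact hE s t (fun j hj => congrFun hst ⟨j, hj⟩) hs
  have := hind.measure_inter_preimage_eq_mul _ _
    (Set.toFinite ((fun (s : ι → Ω) (i : S) => s i) '' E)).measurableSet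
    (Set.toFinite ((fun (s : ι → Ω) (i : T) => s i) '' F)).measurableSet
  rw [hpre hE, hpre hF] at this
  simp only [measureReal_def, this, ENNReal.toReal_mul]

theorem measureReal_biInter_le_pow {κ : Type*} [DecidableEq κ] [DecidableEq ι]
    (E : κ → Set (ι → Ω)) (b : κ → Finset ι)
    (hb : Pairwise fun k l => Disjoint (b k) (b l)) (hE : ∀ k, DependsOnlyOn (E k) (b k)) {q : ℝ}
    (hq : ∀ k, (Measure.pi fun _ : ι => μ).real (E k) ≤ q) (S : Finset κ) :
    (Measure.pi fun _ : ι => μ).real (⋂ k ∈ S, E k) ≤ q ^ S.card := by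
  induction S using Finset.induction_on with
  | empty => simp
  | insert a S ha ih =>
    have hdep : DependsOnlyOn (⋂ k ∈ S, E k) (S.biUnion b) := by
      intro s t hst hs
      simp only [Set.mem_iInter] at hs ⊢
      exact fun k hk =>
        hE k s t (fun j hj => hst j (Finset.mem_biUnion.2 ⟨k, hk, hj⟩)) (hs k hk)
    have hdisj : Disjoint (b a) (S.biUnion b) := by
      rw [Finset.disjoint_biUnion_right]
      exact fun k hk => hb (by rintro rfl; exact ha hk)
    rw [Finset.set_biInter_insert, measureReal_inter_of_dependsOnlyOn μ hdisj (hE a) hdep,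
      Finset.card_insert_of_notMem ha, pow_succ']
    exact mul_le_mul (hq a) ih measureReal_nonneg (measureReal_nonneg.trans (hq a))

theorem measureReal_mean_deviates_le (X : Ω → ℝ) (S : Finset ι) (hS : S.Nonempty) {ε : ℝ}
    (hε : 0 < ε) :
    (Measure.pi fun _ : ι => μ).real {s | ε < |(S.card : ℝ)⁻¹ * ∑ j ∈ S, X (s j) - ∫ x, X x ∂μ|} ≤
      Var[X; μ] / (S.card * ε ^ 2) := by
  set P := Measure.pi fun _ : ι => μ
  have hB : (0 : ℝ) < S.card := Nat.cast_pos.2 hS.card_pos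
  set Y : (ι → Ω) → ℝ := fun s => (S.card : ℝ)⁻¹ * ∑ j ∈ S, X (s j) with hY
  have hmean : ∫ s, Y s ∂P = ∫ x, X x ∂μ := by
    rw [hY, integral_const_mul, integral_finsetSum _ fun _ _ => .of_finite]
    have : ∀ j : ι, ∫ s, X (s j) ∂P = ∫ x, X x ∂μ := fun j =>
      integral_comp_eval (μ := fun _ : ι => μ) Measurable.of_discrete.aestronglyMeasurable
    simp only [this, Finset.sum_const, nsmul_eq_mul]
    field_simp
  have hvar1 : ∀ j : ι, Var[fun s : ι → Ω => X (s j); P] = Var[X; μ] := by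
    intro j
    change Var[X ∘ (fun s : ι → Ω => s j); P] = _
    rw [← variance_map, (measurePreserving_eval (fun _ : ι => μ) j).map_eq]
    · exact Measurable.of_discrete.aemeasurable
    · exact (measurable_pi_apply j).aemeasurable
  have hvar : Var[Y; P] = Var[X; μ] / S.card := by
    rw [hY, variance_const_mul]
    have h1 : (fun s : ι → Ω => ∑ j ∈ S, X (s j)) = ∑ j ∈ S, fun s : ι → Ω => X (s j) := by
      ext s; simp
    rw [h1, IndepFun.variance_sum (fun _ _ => MemLp.of_discrete)]
    · simp only [hvar1, Finset.sum_const, nsmul_eq_mul]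
      field_simp
    · exact fun i _ j _ hij => (iIndepFun_pi (μ := fun _ : ι => μ) (X := fun _ => X)
        fun _ => Measurable.of_discrete.aemeasurable).indepFun hij
  have hcheb := meas_ge_le_variance_div_sq (μ := P) (X := Y) MemLp.of_discrete hε
  calc P.real {s | ε < |Y s - ∫ x, X x ∂μ|} ≤ P.real {s | ε ≤ |Y s - ∫ s, Y s ∂P|} := by
        refine measureReal_mono fun s hs => ?_
        rw [hmean]
        exact le_of_lt (Set.mem_ofPred_eq ▸ hs)
    _ ≤ Var[Y; P] / ε ^ 2 := by
        rw [measureReal_def]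
        exact ENNReal.toReal_le_of_le_ofReal
          (div_nonneg (variance_nonneg _ _) (by positivity)) hcheb
    _ = _ := by rw [hvar, div_div]

end MedianOfMeans

/-! ### Batches of outcomes and the numerical constants. -/

section Prediction

open MeasureTheory ProbabilityTheory

variable {n N K : ℕ}

/-- The positions of the outcomes that form the `k`-th batch. -/
def batch (N K : ℕ) (k : Fin K) : Finset (Fin N) :=
  Finset.univ.filter fun j : Fin N =>
    (k : ℕ) * (N / K) ≤ (j : ℕ) ∧ (j : ℕ) < ((k : ℕ) + 1) * (N / K)

theorem card_batch (k : Fin K) : (batch N K k).card = N / K := by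
  have hN : ((k : ℕ) + 1) * (N / K) ≤ N :=
    (Nat.mul_le_mul_right _ k.2).trans (Nat.mul_div_le N K)
  have : (batch N K k).map Fin.valEmbedding =
      Finset.Ico ((k : ℕ) * (N / K)) (((k : ℕ) + 1) * (N / K)) := by
    ext j
    simp only [batch, Finset.mem_map, Finset.mem_filter, Finset.mem_univ, true_and,
      Fin.valEmbedding_apply, Finset.mem_Ico]
    constructor
    · rintro ⟨j, hj, rfl⟩; exact hj
    · intro hj; exact ⟨⟨j, hj.2.trans_le hN⟩, hj, rfl⟩
  rw [← Finset.card_map Fin.valEmbedding, this, Nat.card_Ico, add_mul, one_mul,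
    Nat.add_sub_cancel_left]

theorem disjoint_batch : Pairwise fun k l : Fin K => Disjoint (batch N K k) (batch N K l) := by
  intro k l hkl
  rw [Finset.disjoint_left]
  intro j hk hl
  simp only [batch, Finset.mem_filter, Finset.mem_univ, true_and] at hk hl
  have h1 := Nat.lt_of_mul_lt_mul_right (hk.1.trans_lt hl.2)
  have h2 := Nat.lt_of_mul_lt_mul_right (hl.1.trans_lt hk.2)
  exact hkl (Fin.ext (by omega))

theorem trace_mul_batchEstimator_re (A : QMat n) (s : Fin N → StabState n) (k : Fin K)
    (hB : N / K ≠ 0) :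
    (A * batchEstimator K s k).trace.re =
      ((batch N K k).card : ℝ)⁻¹ * ∑ j ∈ batch N K k, shot A (s j) := by
  have hc : ((2 : ℂ) ^ n + 1) / ((N / K : ℕ) : ℂ) =
      (((2 : ℝ) ^ n + 1) / ((N / K : ℕ) : ℝ) : ℝ) := by push_cast; rfl
  have hB' : ((N / K : ℕ) : ℝ) ≠ 0 := Nat.cast_ne_zero.2 hB
  simp only [shot, Finset.sum_sub_distrib, Finset.sum_const, card_batch, nsmul_eq_mul,
    ← Finset.mul_sum, overlap]
  rw [batchEstimator, hc, mul_sub, mul_one, Matrix.trace_sub, Matrix.mul_smul, Matrix.trace_smul,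
    Complex.sub_re, smul_eq_mul, Complex.re_ofReal_mul, Finset.mul_sum, Matrix.trace_sum,
    Complex.re_sum]
  change _ * ∑ j ∈ batch N K k, _ - _ = _
  field_simp

theorem measureReal_medianOfMeans_deviates_le {ρ : QMat n} (hρ : IsState ρ) {A : QMat n}
    (hA : A.IsHermitian) {ε q : ℝ} (hε : 0 < ε) (hK : 0 < K) (hKN : K ≤ N)
    (hq : 3 * (A * A).trace.re / ((N / K : ℕ) * ε ^ 2) ≤ q) :
    (Measure.pi fun _ : Fin N => stabilizerMeasurement ρ).real
        {s | ε < |medianOfMeans K A s - (A * ρ).trace.re|} ≤ 2 ^ K * q ^ ((K + 1) / 2) := by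
  have := isProbabilityMeasure_stabilizerMeasurement hρ
  have hB : 0 < N / K := Nat.div_pos hKN hK
  set E : Fin K → Set (Fin N → StabState n) := fun k =>
    {s | ε < |((batch N K k).card : ℝ)⁻¹ * ∑ j ∈ batch N K k, shot A (s j) -
      ∫ x, shot A x ∂stabilizerMeasurement ρ|} with hE
  have hEq : ∀ k, (Measure.pi fun _ : Fin N => stabilizerMeasurement ρ).real (E k) ≤ q := by
    intro k
    refine (measureReal_mean_deviates_le _ (shot A) (batch N K k)
      (Finset.card_pos.1 (by rwa [card_batch])) hε).trans (le_trans ?_ hq)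
    rw [card_batch]
    have := variance_shot_le hρ hA
    gcongr
  refine measureReal_le_card_mem_le _ E (measureReal_nonneg.trans (hEq ⟨0, hK⟩))
    (measureReal_biInter_le_pow _ E (batch N K) disjoint_batch ?_ hEq) _ _ ?_
  · intro k s t hst hs
    have : ∑ j ∈ batch N K k, shot A (s j) = ∑ j ∈ batch N K k, shot A (t j) :=
      Finset.sum_congr rfl fun j hj => by rw [hst j hj]
    simp only [hE, Set.mem_ofPred_eq] at hs ⊢
    rwa [← this]
  · intro s hs
    refine ⟨_, card_deviating_of_median_deviates hK _ _ _ hs, fun k hk => ?_⟩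
    have := (Finset.mem_filter.1 hk).2
    rw [trace_mul_batchEstimator_re A s k hB.ne'] at this
    simp only [hE, Set.mem_ofPred_eq]
    rwa [integral_shot hρ hA]

/-- With `h = ⌈K/2⌉`, the factor `2^K` is at most `4^h`, so the product is at most `(4q)^h`. -/
theorem two_pow_mul_pow_le {q c : ℝ} (hq : 0 ≤ q) (hc : 4 * q ≤ Real.exp (-c)) (K : ℕ) :
    2 ^ K * q ^ ((K + 1) / 2) ≤ Real.exp (-(c * ((K + 1) / 2 : ℕ))) := by
  set h := (K + 1) / 2 with hh
  calc (2 : ℝ) ^ K * q ^ h ≤ 2 ^ (2 * h) * q ^ h := by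
        gcongr
        · norm_num
        · omega
    _ = (4 * q) ^ h := by rw [pow_mul, mul_pow]; norm_num
    _ ≤ Real.exp (-c) ^ h := by gcongr
    _ = _ := by rw [← Real.exp_nat_mul]; congr 1; ring

theorem two_pow_mul_pow_le_inv {x : ℝ} (hx : 1 ≤ x) (hK : 0 < K)
    (hKx : K = ⌈Real.log x⌉₊ ∨ K = ⌈2 * Real.log (2 * x)⌉₊) :
    2 ^ K * (3 * (2 * (K : ℝ) - 1) / (204 * Real.log (2 * x))) ^ ((K + 1) / 2) ≤ x⁻¹ := by
  have hx0 : 0 < x := by linarith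
  have hlog : 0 ≤ Real.log x := Real.log_nonneg hx
  have hL : Real.log (2 * x) = Real.log 2 + Real.log x := Real.log_mul (by norm_num) hx0.ne'
  have hl2 := Real.log_two_gt_d9
  have hK1 : (1 : ℝ) ≤ K := by exact_mod_cast hK
  have hLpos : 0 < Real.log (2 * x) := by rw [hL]; linarith
  have he := Real.exp_one_lt_d9
  have hepos := Real.exp_pos 1
  have hq0 : 0 ≤ 3 * (2 * (K : ℝ) - 1) / (204 * Real.log (2 * x)) :=
    div_nonneg (by linarith) (by linarith)
  have hh : (K : ℝ) ≤ 2 * ((K + 1) / 2 : ℕ) := by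
    have : K ≤ 2 * ((K + 1) / 2) := by omega
    exact_mod_cast this
  have hxinv : x⁻¹ = Real.exp (-Real.log x) := by rw [Real.exp_neg, Real.exp_log hx0]
  rw [hxinv]
  rcases hKx with h | h
  · have hup : (K : ℝ) < Real.log x + 1 := by rw [h]; exact Nat.ceil_lt_add_one hlog
    have hlo : Real.log x ≤ K := by rw [h]; exact Nat.le_ceil _
    -- Here `4q = (2K-1)/(17 log(2x))` is at most `2/17`, because `K < log x + 1` and `2 log 2 ≥ 1`;
    -- moreover `e² ≤ 17/2`.
    refine (two_pow_mul_pow_le (c := 2) hq0 ?_ K).trans ?_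
    · have h2 : Real.exp (-2) = (Real.exp 1 * Real.exp 1)⁻¹ := by
        rw [← Real.exp_add, ← Real.exp_neg]; norm_num
      have h3 : Real.exp 1 * Real.exp 1 ≤ 17 / 2 := by nlinarith
      calc 4 * (3 * (2 * (K : ℝ) - 1) / (204 * Real.log (2 * x))) ≤ (17 / 2)⁻¹ := by
            rw [← mul_div_assoc, div_le_iff₀ (by linarith), hL]
            linarith
        _ ≤ _ := by rw [h2]; gcongr
    · exact Real.exp_le_exp.2 (by linarith)
  · have hup : (K : ℝ) < 2 * Real.log (2 * x) + 1 := by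
      rw [h]; exact Nat.ceil_lt_add_one (by linarith)
    have hlo : 2 * Real.log (2 * x) ≤ K := by rw [h]; exact Nat.le_ceil _
    -- With `L = log(2x) ≥ log 2`, now `4q ≤ (4L+1)/(17L) ≤ 1/2.72 < e⁻¹`. The larger `K` makes the
    -- exponent 1 suffice.
    refine (two_pow_mul_pow_le (c := 1) hq0 ?_ K).trans ?_
    · calc 4 * (3 * (2 * (K : ℝ) - 1) / (204 * Real.log (2 * x))) ≤ (2.72)⁻¹ := by
            rw [← mul_div_assoc, div_le_iff₀ (by linarith)]
            rw [hL] at hup ⊢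
            linarith
        _ ≤ _ := by
            rw [Real.exp_neg]
            gcongr
            linarith
    · exact Real.exp_le_exp.2 (by linarith)

end Prediction

end ClassicalShadows

/-! ### Union bound over the observables. -/

theorem theorem1 (n M : ℕ) (hM : 0 < M)
    (O : Fin M → ClassicalShadows.QMat n) (hO : ∀ i, (O i).IsHermitian)
    (ε δ : ℝ) (hε : ε ∈ Set.Ioc (0 : ℝ) 1) (hδ : δ ∈ Set.Ioc (0 : ℝ) 1)
    (N K : ℕ)
    (hN : 204 * Real.log (2 * (M : ℝ) / δ) * (⨆ i, (O i * O i).trace.re) / ε ^ 2 ≤ (N : ℝ))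
    (hK : K = ⌈Real.log ((M : ℝ) / δ)⌉₊ ∨ K = ⌈2 * Real.log (2 * (M : ℝ) / δ)⌉₊)
    (hKN : K ≤ N)
    (ρ : ClassicalShadows.QMat n) (hρ : ClassicalShadows.IsState ρ) :
    ENNReal.ofReal (1 - δ) ≤
      MeasureTheory.Measure.pi
        (fun _ : Fin N => ClassicalShadows.stabilizerMeasurement ρ)
        {s | ∀ i, |ClassicalShadows.medianOfMeans K (O i) s - (O i * ρ).trace.re| ≤ ε} := by
  have := ClassicalShadows.isProbabilityMeasure_stabilizerMeasurement hρ
  have hM1 : (1 : ℝ) ≤ M := by exact_mod_cast hM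
  have hx : 1 ≤ (M : ℝ) / δ := (one_le_div hδ.1).2 (hδ.2.trans hM1)
  rw [mul_div_assoc 2 (M : ℝ) δ] at hN hK
  have hl2 : 0 < Real.log (2 * ((M : ℝ) / δ)) := Real.log_pos (by linarith)
  rcases Nat.eq_zero_or_pos K with hK0 | hK0
  -- No batches means `log(M/δ) ≤ 0`, hence `δ = 1`, and the claimed probability is 0.
  · have hδ1 : δ = 1 := by
      have hle : Real.log ((M : ℝ) / δ) ≤ 0 := by
        rcases hK with h | h
        · rw [hK0] at h; exact Nat.ceil_eq_zero.1 h.symm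
        · rw [hK0] at h
          have := Nat.ceil_eq_zero.1 h.symm
          linarith
      have h1 : (M : ℝ) / δ ≤ 1 := by
        by_contra! h
        exact absurd (Real.log_pos h) (not_lt.2 hle)
      rw [div_le_one hδ.1] at h1
      exact le_antisymm hδ.2 (hM1.trans h1)
    simp [hδ1]
  set P := MeasureTheory.Measure.pi fun _ : Fin N => ClassicalShadows.stabilizerMeasurement ρ
  have hB : 0 < N / K := Nat.div_pos hKN hK0
  have hB' : (1 : ℝ) ≤ (N / K : ℕ) := by exact_mod_cast hB
  have hK1 : (1 : ℝ) ≤ K := by exact_mod_cast hK0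
  -- The remainder of `N` modulo `K` is at most `K - 1`, hence at most `(K - 1)⌊N/K⌋` as `⌊N/K⌋ ≥
  -- 1`. This is the source of the factor `2K - 1`.
  have hNle : (N : ℝ) ≤ (2 * K - 1) * (N / K : ℕ) := by
    have h1 : N + 1 ≤ K * (N / K) + K := by
      have := Nat.lt_mul_div_succ N hK0
      rw [mul_add, mul_one] at this
      exact this
    have h2 : (N : ℝ) + 1 ≤ K * (N / K : ℕ) + K := by exact_mod_cast h1
    nlinarith
  have hbad : ∀ i, P.real {s | ε < |ClassicalShadows.medianOfMeans K (O i) s -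
      (O i * ρ).trace.re|} ≤ ((M : ℝ) / δ)⁻¹ := by
    intro i
    refine (ClassicalShadows.measureReal_medianOfMeans_deviates_le hρ (hO i) hε.1 hK0 hKN
      ?_).trans (ClassicalShadows.two_pow_mul_pow_le_inv hx hK0 hK)
    have hsup : (O i * O i).trace.re ≤ ⨆ i, (O i * O i).trace.re :=
      le_ciSup (f := fun i => (O i * O i).trace.re) (Set.finite_range _).bddAbove i
    have hε2 : 0 < ε ^ 2 := pow_pos hε.1 2
    have h1 := hN.trans hNle
    rw [div_le_iff₀ hε2] at h1
    rw [div_le_div_iff₀ (by positivity) (by positivity)]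
    have h2 := mul_le_mul_of_nonneg_left hsup hl2.le
    nlinarith
  have hunion : P.real (⋃ i, {s | ε < |ClassicalShadows.medianOfMeans K (O i) s -
      (O i * ρ).trace.re|}) ≤ δ := by
    refine (MeasureTheory.measureReal_iUnion_fintype_le _).trans
      ((Finset.sum_le_sum fun i _ => hbad i).trans ?_)
    rw [Finset.sum_const, Finset.card_univ, Fintype.card_fin, nsmul_eq_mul, inv_div]
    exact (mul_div_cancel₀ δ (by positivity)).le
  have hcompl : {s : Fin N → ClassicalShadows.StabState n | ∀ i, |ClassicalShadows.medianOfMeans K (O i) s -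
      (O i * ρ).trace.re| ≤ ε} =
      (⋃ i, {s | ε < |ClassicalShadows.medianOfMeans K (O i) s - (O i * ρ).trace.re|})ᶜ := by
    ext s
    simp
  rw [hcompl, ← MeasureTheory.ofReal_measureReal]
  refine ENNReal.ofReal_le_ofReal ?_
  rw [MeasureTheory.probReal_compl_eq_one_sub (Set.toFinite _).measurableSet]
  linarith
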